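/- **Theorem 5.1.** Let $M$ be a smooth Riemannian manifold of dimension $n$ with metric $g$, let $\mathbb R^+=(0,\infty)$ and $\mathcal M=M\times\mathbb R^+$, with local coordinates $x^1,\dots,x^n$ on $M$ and $v$ on $\mathbb R^+$. All functions, forms and vector fields are $C^\infty$. A *force field* $\mathbf F$ on $M$ assigns to each $p\in M$ and each nonzero velocity $\mathbf v\in T_pM$ a vector $\mathbf F(p,\mathbf v)\in T_pM$. A pair $(h,W)$, where $W$ is a smooth function on an open set $O\subset\mathcal M$ with $W_v=\partial W/\partial v\ne0$ on $O$, and $h$ is a smooth function of one variable on $W(O)$, *represents* $\mathbf F$ in $O$ if for all $p$ and $\mathbf v\neq 0$ with $(p,|\mathbf v|)\in O$ $$F_k=\frac{h(W)\,N_k}{W_v}-v\sum_{i=1}^n\frac{\nabla_iW}{W_v}\bigl(2N^iN_k-\delta^i_k\bigr),\qquad v=|\mathbf v|,\quad \mathbf N=\frac{\mathbf v}{|\mathbf v|},\quad \nabla_iW=\frac{\partial W}{\partial x^i},\tag{1.4}$$ where $W$ and its derivatives are taken at $(p,|\mathbf v|)$ and indices are lowered by $g$. The force field $\mathbf F$ *is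 of the form (1.4)* if every point of $\mathcal M$ has an open neighborhood in which $\mathbf F$ is represented by some pair $(h,W)$. Let $\mathcal P^*\!\mathcal M$ be the bundle over $\mathcal M$ whose fiber at $q$ is the projective space of $T^*_q\mathcal M$. A smooth global section $\sigma$ of it is locally the class $[\omega]$ of a smooth nowhere vanishing $1$-form $\omega$, and $\operatorname{Ker}\sigma=\operatorname{Ker}\omega\subset T\mathcal M$ is a well-defined distribution. The section $\sigma$ is *closed* if $\operatorname{Ker}\sigma$ is involutive, that is, if the Lie bracket of any two (locally defined) smooth vector fields belonging to $\operatorname{Ker}\sigma$ belongs to $\operatorname{Ker}\sigma$. It is *transversal to the rulings* if at each $q=(p,v)$ the space $T_q\mathcal M$ is the direct sum of $\operatorname{Ker}\sigma_q$ and the tangent line of $\{p\}\times\mathbb R^+$. A section $\sigma$ *corresponds* to a force field $\mathbf F$ of the form (1.4) if $\sigma_q=[dW_q]$ for every pair $(h,W)$ that represents $\mathbf F$ in an open set $O$ and every $q\in O$. 1. For every force field $\mathbf F$ of the form (1.4) there is exactly one global section $\sigma$ of $\mathcal P^*\!\mathcal M$ that corresponds to $\mathbf F$. This section is smooth, closed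 and transversal to the rulings. 2. Conversely, every smooth closed global section of $\mathcal P^*\!\mathcal M$ that is transversal to the rulings corresponds to some force field of the form (1.4). -/

import Mathlib

open scoped Manifold ContDiff Bundle

namespace NormalShift

noncomputable section

/-- The half-line `ℝ⁺` of positive real numbers, as an open submanifold of `ℝ`. -/
abbrev PosReal : TopologicalSpace.Opens ℝ := ⟨Set.Ioi 0, isOpen_Ioi⟩

/-- The cylinder `M × ℝ⁺` over `M`. -/
abbrev Cyl (M : Type*) : Type _ := M × PosReal

/-- The model with corners of the cylinder `M × ℝ⁺` over an `n`-dimensional manifold `M`. -/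
abbrev cylModel (n : ℕ) :
    ModelWithCorners ℝ (EuclideanSpace ℝ (Fin n) × ℝ)
      (ModelProd (EuclideanSpace ℝ (Fin n)) ℝ) :=
  (𝓡 n).prod 𝓘(ℝ, ℝ)

variable {n : ℕ} {M : Type*} [TopologicalSpace M] [ChartedSpace (EuclideanSpace ℝ (Fin n)) M]

/-! ### Functions on the cylinder and their derivatives -/

/-- The differential `dW` of a function on `M × ℝ⁺` at the point `q`, a cotangent vector at `q`. -/
def differential (n : ℕ) {M : Type*} [TopologicalSpace M]
    [ChartedSpace (EuclideanSpace ℝ (Fin n)) M] (W : Cyl M → ℝ) (q : Cyl M) :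
    TangentSpace (cylModel n) q →L[ℝ] ℝ :=
  mfderiv (cylModel n) 𝓘(ℝ, ℝ) W q

/-- The partial gradient `∇W` at `q = (p, v)`: the differential at `p` of `x ↦ W (x, v)`; its
components in local coordinates of `M` are `∂W/∂xⁱ`. -/
def gradM (n : ℕ) {M : Type*} [TopologicalSpace M]
    [ChartedSpace (EuclideanSpace ℝ (Fin n)) M] (W : Cyl M → ℝ) (q : Cyl M) :
    TangentSpace (𝓡 n) q.1 →L[ℝ] ℝ :=
  mfderiv (𝓡 n) 𝓘(ℝ, ℝ) (fun x : M => W (x, q.2)) q.1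

/-- The partial derivative `W_v = ∂W/∂v` at `q = (p, v)`. The canonical chart of `ℝ⁺` is its
inclusion in `ℝ`, so the tangent vector `1` is `∂/∂v`. -/
def derivV {M : Type*} (W : Cyl M → ℝ) (q : Cyl M) : ℝ :=
  mfderiv 𝓘(ℝ, ℝ) 𝓘(ℝ, ℝ) (fun s : PosReal => W (q.1, s)) q.2 (1 : ℝ)

/-! ### Force fields -/

/-- A smooth Riemannian metric on the `n`-dimensional manifold `M`. -/
abbrev Metric (n : ℕ) (M : Type*) [TopologicalSpace M]
    [ChartedSpace (EuclideanSpace ℝ (Fin n)) M] [IsManifold (𝓡 n) ∞ M] : Type _ :=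
  Bundle.ContMDiffRiemannianMetric (𝓡 n) ∞ (EuclideanSpace ℝ (Fin n))
    (fun p : M => TangentSpace (𝓡 n) p)

/-- A force field: to each point `p` of `M` and each nonzero velocity vector at `p` it assigns
a tangent vector at `p`. -/
abbrev ForceField (n : ℕ) (M : Type*) [TopologicalSpace M]
    [ChartedSpace (EuclideanSpace ℝ (Fin n)) M] : Type _ :=
  ∀ p : M, {u : TangentSpace (𝓡 n) p // u ≠ 0} → TangentSpace (𝓡 n) p

/-- The modulus `|u|` of a nonzero tangent vector, a positive real number. -/
def speed [IsManifold (𝓡 n) ∞ M] (g : Metric n M) (p : M)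
    (u : {u : TangentSpace (𝓡 n) p // u ≠ 0}) : PosReal :=
  ⟨√(g.inner p u.1 u.1), Real.sqrt_pos.2 (g.pos p u.1 u.2)⟩

/-- The unit vector `N = u / |u|` in the direction of a nonzero tangent vector `u`. -/
def unitDir [IsManifold (𝓡 n) ∞ M] (g : Metric n M) (p : M)
    (u : {u : TangentSpace (𝓡 n) p // u ≠ 0}) : TangentSpace (𝓡 n) p :=
  (speed g p u : ℝ)⁻¹ • u.1

/-- The pair of functions `h = h(w)`, `W = W(x, v)`, the second one defined in the domain
`O ⊆ M × ℝ⁺`, represents the force field `F` in `O`: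
`F_k = h(W) N_k / W_v - v ∑ᵢ (∇ᵢW / W_v) (2 Nⁱ N_k - δⁱ_k)` with `W_v ≠ 0`, where `v = |u|` is the
modulus of the velocity vector `u`. The formula is contracted with an arbitrary vector `Xᵏ`:
`F_k Xᵏ = g(F, X)`, `N_k Xᵏ = g(N, X)`, `∑ᵢ ∇ᵢW Nⁱ = ∇W(N)`, `∑ᵢ ∇ᵢW δⁱ_k Xᵏ = ∇W(X)`. -/
structure Represents [IsManifold (𝓡 n) ∞ M] (g : Metric n M) (F : ForceField n M)
    (O : Set (Cyl M)) (h : ℝ → ℝ) (W : Cyl M → ℝ) : Prop where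
  isOpen : IsOpen O
  smooth_W : ContMDiffOn (cylModel n) 𝓘(ℝ, ℝ) ∞ W O
  smooth_h : ContDiffOn ℝ ∞ h (W '' O)
  derivV_ne_zero : ∀ q ∈ O, derivV W q ≠ 0
  formula : ∀ (p : M) (u : {u : TangentSpace (𝓡 n) p // u ≠ 0}), (p, speed g p u) ∈ O →
    ∀ X : TangentSpace (𝓡 n) p,
      g.inner p (F p u) X =
        h (W (p, speed g p u)) * g.inner p (unitDir g p u) X / derivV W (p, speed g p u)
          - (speed g p u : ℝ) *
            (2 * (gradM n W (p, speed g p u) (unitDir g p u) / derivV W (p, speed g p u))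
                * g.inner p (unitDir g p u) X
              - gradM n W (p, speed g p u) X / derivV W (p, speed g p u))

/-- The global force field `F` has the normal shift form: near each point of `M × ℝ⁺` it is
represented by some pair of functions `(h, W)`. -/
def HasNormalShiftForm [IsManifold (𝓡 n) ∞ M] (g : Metric n M) (F : ForceField n M) : Prop :=
  ∀ q : Cyl M, ∃ (O : Set (Cyl M)) (h : ℝ → ℝ) (W : Cyl M → ℝ),
    q ∈ O ∧ Represents g F O h W

/-! ### Sections of the projectivized cotangent bundle of the cylinder -/

/-- A (set-theoretic) global section of the projectivized cotangent bundle of `M × ℝ⁺`: a point of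
the projective space of the cotangent space at each point. -/
abbrev ProjSection (n : ℕ) (M : Type*) [TopologicalSpace M]
    [ChartedSpace (EuclideanSpace ℝ (Fin n)) M] : Type _ :=
  ∀ q : Cyl M, Projectivization ℝ (TangentSpace (cylModel n) q →L[ℝ] ℝ)

/-- The section is smooth: near each point it is represented by a smooth nowhere vanishing
differential 1-form. -/
def IsSmoothSection [IsManifold (𝓡 n) ∞ M] (σ : ProjSection n M) : Prop :=
  ∀ q₀ : Cyl M, ∃ (O : Set (Cyl M)) (θ : ∀ q : Cyl M, TangentSpace (cylModel n) q →L[ℝ] ℝ),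
    IsOpen O ∧ q₀ ∈ O ∧
    ContMDiffOn (cylModel n)
      ((cylModel n).prod 𝓘(ℝ, (EuclideanSpace ℝ (Fin n) × ℝ) →L[ℝ] ℝ)) ∞
      (fun q => (⟨q, θ q⟩ : Bundle.TotalSpace ((EuclideanSpace ℝ (Fin n) × ℝ) →L[ℝ] ℝ)
        (fun q : Cyl M => TangentSpace (cylModel n) q →L[ℝ] Bundle.Trivial (Cyl M) ℝ q))) O ∧
    ∀ q ∈ O, ∃ hθ : θ q ≠ 0, σ q = Projectivization.mk ℝ (θ q) hθ

/-- The distribution `U = Ker σ` on `M × ℝ⁺`: the kernel of any representative of `σ q`. -/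
def kerSection (σ : ProjSection n M) (q : Cyl M) : Submodule ℝ (TangentSpace (cylModel n) q) :=
  LinearMap.ker ((σ q).rep : TangentSpace (cylModel n) q →ₗ[ℝ] ℝ)

/-- A field of tangent subspaces on the cylinder is involutive: the Lie bracket of two (locally
defined) smooth vector fields that belong to it belongs to it. -/
def IsInvolutive [IsManifold (𝓡 n) ∞ M]
    (U : ∀ q : Cyl M, Submodule ℝ (TangentSpace (cylModel n) q)) : Prop :=
  ∀ (O : Set (Cyl M)) (X Y : ∀ q : Cyl M, TangentSpace (cylModel n) q), IsOpen O →
    ContMDiffOn (cylModel n) (cylModel n).tangent ∞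
      (fun q => (⟨q, X q⟩ : TangentBundle (cylModel n) (Cyl M))) O →
    ContMDiffOn (cylModel n) (cylModel n).tangent ∞
      (fun q => (⟨q, Y q⟩ : TangentBundle (cylModel n) (Cyl M))) O →
    (∀ q ∈ O, X q ∈ U q) → (∀ q ∈ O, Y q ∈ U q) →
    ∀ q ∈ O, VectorField.mlieBracket (cylModel n) X Y q ∈ U q

/-- A section of the projectivized cotangent bundle is closed if its kernel distribution is
involutive. -/
def IsClosedSection [IsManifold (𝓡 n) ∞ M] (σ : ProjSection n M) : Prop :=
  IsInvolutive (kerSection σ)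

/-- The tangent line at `q = (p, v)` of the linear ruling `{p} × ℝ⁺` of the cylinder. -/
def rulingTangent (n : ℕ) {M : Type*} [TopologicalSpace M]
    [ChartedSpace (EuclideanSpace ℝ (Fin n)) M] (q : Cyl M) :
    Submodule ℝ (TangentSpace (cylModel n) q) :=
  LinearMap.range (mfderiv 𝓘(ℝ, ℝ) (cylModel n) (fun s : PosReal => ((q.1, s) : Cyl M)) q.2 :
    TangentSpace 𝓘(ℝ, ℝ) q.2 →ₗ[ℝ] TangentSpace (cylModel n) q)

/-- The kernel distribution of the section is transversal to the linear rulings of `M × ℝ⁺`. -/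
def IsTransversal (σ : ProjSection n M) : Prop :=
  ∀ q : Cyl M, IsCompl (kerSection σ q) (rulingTangent n q)

/-- `σ` is the section determined by `F`: for every pair `(h, W)` that represents `F` in a domain
`O`, the value of `σ` at each point of `O` is the class of `dW`. -/
def Determines [IsManifold (𝓡 n) ∞ M] (g : Metric n M) (F : ForceField n M)
    (σ : ProjSection n M) : Prop :=
  ∀ (O : Set (Cyl M)) (h : ℝ → ℝ) (W : Cyl M → ℝ), Represents g F O h W →
    ∀ q ∈ O, ∃ hW : differential n W q ≠ 0,
      σ q = Projectivization.mk ℝ (differential n W q) hW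

end

end NormalShift

/-! In (1.4) the pair `(h, W)` enters at a given `(p, v)` only through the number `a = h(W)/W_v`,
which does not depend on the direction of the velocity, and the covector `b = ∇W/W_v`. Contracting
the force with the velocity `u` itself leaves `v (a - b(u))`. Comparing `u` with `-u` separates the
odd part, so the force determines `b` (`eq_of_force_eq`). Since `dW = W_v (dv + b)`, the class
`[dW]` is determined too, and local pairs glue to one section. It is smooth because `dW` is,
transversal because `W_v ≠ 0`, and closed because the kernel of an exact form is involutive
(`mfderiv_mlieBracket_eq_zero`).

Conversely, transversality lets `σ` be written in a chart as the class of `dv - a dx`, and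
involutivity becomes the integrability condition on `a`. The Frobenius theorem
(`exists_first_integral`) then yields a local `W` with `σ = [dW]`. The covector `b = ∇W/W_v` depends
on `σ` alone, so (1.4) with `h = 0` defines a global force field. By the first half every pair
representing it gives back `σ`.

For Frobenius, leaves are graphs of solutions of `y' = a(x, y)`, built by solving an ordinary
differential equation along the rays from `x₀`. Smooth dependence on the data comes from the inverse
function theorem in the Banach space of continuous functions on the unit interval, where
postcomposition with a smooth map is smooth (`contDiff_postcomp`). Integrability makes the radial
solutions solve the equation in all directions (`ray_variation`). Inverting `(x, w) ↦ (x, Y(x, w))`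
gives the first integral, the label `w` of the leaf. -/

namespace NormalShift

open Set Filter Topology

universe u

/-! ### Postcomposition as a smooth operation on spaces of continuous functions -/

section Postcomposition

variable {K : Type*} [TopologicalSpace K] [CompactSpace K]
  {E F G : Type*} [NormedAddCommGroup E] [NormedSpace ℝ E] [NormedAddCommGroup F] [NormedSpace ℝ F]
  [NormedAddCommGroup G] [NormedSpace ℝ G]

/-- Pointwise application of a continuous bilinear map to continuous functions. -/
noncomputable def bilinMap (K : Type*) [TopologicalSpace K] [CompactSpace K]
    (B : E →L[ℝ] F →L[ℝ] G) : C(K, E) →L[ℝ] C(K, F) →L[ℝ] C(K, G) :=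
  LinearMap.mkContinuous₂
    (LinearMap.mk₂ ℝ
      (fun (u : C(K, E)) (w : C(K, F)) => (⟨fun s => B (u s) (w s), by fun_prop⟩ : C(K, G)))
      (fun _ _ _ => by ext; simp) (fun _ _ _ => by ext; simp)
      (fun _ _ _ => by ext; simp) (fun _ _ _ => by ext; simp)) ‖B‖
    (fun u w => by
      refine (ContinuousMap.norm_le _ (by positivity)).2 fun s => ?_
      refine (B.le_opNorm₂ _ _).trans ?_
      gcongr
      · exact u.norm_coe_le_norm s
      · exact w.norm_coe_le_norm s)

@[simp] lemma bilinMap_apply (B : E →L[ℝ] F →L[ℝ] G) (u : C(K, E)) (w : C(K, F)) (s : K) :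
    bilinMap K B u w s = B (u s) (w s) := rfl

/-- Constant functions, as a continuous linear map. -/
noncomputable def constMap (K : Type*) [TopologicalSpace K] [CompactSpace K] (E : Type*)
    [NormedAddCommGroup E] [NormedSpace ℝ E] : E →L[ℝ] C(K, E) :=
  LinearMap.mkContinuous
    { toFun := fun e => ContinuousMap.const K e
      map_add' := fun _ _ => rfl
      map_smul' := fun _ _ => rfl } 1
    (fun e => (ContinuousMap.norm_le _ (by positivity)).2 fun s => by
      rw [one_mul]; exact le_rfl)

@[simp] lemma constMap_apply (e : E) (s : K) : constMap K E e s = e := rfl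

/-- The derivative of a `C¹` function as a continuous map. -/
noncomputable def fderivMap (f : C(E, F)) (hf : ContDiff ℝ 1 f) : C(E, E →L[ℝ] F) :=
  ⟨fderiv ℝ f, hf.continuous_fderiv one_ne_zero⟩

/-- The derivative of postcomposition with a `C¹` function. -/
noncomputable def postcompDeriv (f : C(E, F)) (hf : ContDiff ℝ 1 f) (u : C(K, E)) :
    C(K, E) →L[ℝ] C(K, F) :=
  bilinMap K (ContinuousLinearMap.id ℝ (E →L[ℝ] F)) ((fderivMap f hf).comp u)

@[simp] lemma postcompDeriv_apply (f : C(E, F)) (hf : ContDiff ℝ 1 f) (u h : C(K, E)) (s : K) :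
    postcompDeriv f hf u h s = fderiv ℝ f (u s) (h s) := rfl

-- At each `s` the mean value inequality bounds the remainder by the oscillation of `f'` near `u s`;
-- compactness of `K` makes this bound uniform in `s`.
set_option synthInstance.maxHeartbeats 200000 in
theorem hasFDerivAt_postcomp (f : C(E, F)) (hf : ContDiff ℝ 1 f) (u : C(K, E)) :
    HasFDerivAt (fun u : C(K, E) => f.comp u)
      (postcompDeriv f hf u) u := by
  rw [hasFDerivAt_iff_isLittleO_nhds_zero, Asymptotics.isLittleO_iff]
  intro ε hε
  -- `E` need not be locally compact, so uniformity is obtained by currying: `e ↦ (s ↦ f'(u s + e))`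
  -- is continuous into the sup norm.
  let Φ : C(E × K, E →L[ℝ] F) :=
    ⟨fun p => fderiv ℝ f (u p.2 + p.1), (fderivMap f hf).continuous.comp (by fun_prop)⟩
  have hΦ : ∀ᶠ e in 𝓝 (0 : E), dist (Φ.curry e) (Φ.curry 0) < ε :=
    Metric.tendsto_nhds.1 (Φ.curry.continuous.tendsto 0) ε hε
  obtain ⟨δ, hδ, hball⟩ := Metric.eventually_nhds_iff_ball.1 hΦ
  filter_upwards [Metric.ball_mem_nhds (0 : C(K, E)) hδ] with h hh
  refine (ContinuousMap.norm_le _ (by positivity)).2 fun s => ?_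
  have hhs : ‖h s‖ < δ := (h.norm_coe_le_norm s).trans_lt (by simpa using hh)
  have key := (convex_ball (u s) δ).norm_image_sub_le_of_norm_hasFDerivWithin_le'
    (f := f) (f' := fderiv ℝ f) (φ := fderiv ℝ f (u s)) (C := ε) (x := u s) (y := u s + h s)
    (fun x _ => (hf.differentiable one_ne_zero x).hasFDerivAt.hasFDerivWithinAt) (fun x hx => by
      have h1 := hball (x - u s) (by simpa [dist_eq_norm] using hx)
      have h2 := (ContinuousMap.dist_apply_le_dist (f := Φ.curry (x - u s))
        (g := Φ.curry 0) s).trans h1.le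
      have h3 : ‖fderiv ℝ f (u s + (x - u s)) - fderiv ℝ f (u s + 0)‖ ≤ ε := by
        rw [← dist_eq_norm]; exact h2
      simpa using h3) (by simpa using hδ) (by simpa using hhs)
  calc _ = ‖f (u s + h s) - f (u s) - fderiv ℝ f (u s) (u s + h s - u s)‖ := by
        simp
    _ ≤ ε * ‖u s + h s - u s‖ := key
    _ ≤ ε * ‖h‖ := by
        rw [add_sub_cancel_left]; gcongr; exact h.norm_coe_le_norm s

/-- The derivative of `p ↦ a (c + L p) (M p)`, where `L` and `M` are linear with values in spaces
of continuous functions. -/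
theorem hasFDerivAt_apply_postcomp {P V : Type*} [NormedAddCommGroup P] [NormedSpace ℝ P]
    [NormedAddCommGroup V] [NormedSpace ℝ V] (a : C(V, E →L[ℝ] F)) (ha : ContDiff ℝ 1 a)
    (c : C(K, V)) (L : P →L[ℝ] C(K, V)) (M : P →L[ℝ] C(K, E)) (p : P) :
    ∃ D : P →L[ℝ] C(K, F),
      HasFDerivAt (fun p => bilinMap K (ContinuousLinearMap.id ℝ (E →L[ℝ] F))
        (a.comp (c + L p)) (M p)) D p ∧
      ∀ q, D q = bilinMap K (ContinuousLinearMap.id ℝ (E →L[ℝ] F)) (a.comp (c + L p)) (M q) +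
        bilinMap K (ContinuousLinearMap.id ℝ (E →L[ℝ] F))
          (postcompDeriv a ha (c + L p) (L q)) (M p) := by
  have h1 : HasFDerivAt (fun p => c + L p) L p := L.hasFDerivAt.const_add c
  have h2 := (hasFDerivAt_postcomp a ha (c + L p)).comp p h1
  exact ⟨_, (bilinMap K (ContinuousLinearMap.id ℝ (E →L[ℝ] F))).hasFDerivAt_of_bilinear h2
    M.hasFDerivAt, fun q => rfl⟩

end Postcomposition

/-- The derivative is postcomposition with `f'` followed by a fixed bounded linear map, so induction
applies. It replaces `F` by `E →L[ℝ] F`; hence `F` is quantified inside and shares the universe of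
`E`. -/
theorem contDiff_postcomp_nat {K : Type*} [TopologicalSpace K] [CompactSpace K] {E : Type u}
    [NormedAddCommGroup E] [NormedSpace ℝ E] (m : ℕ) :
    ∀ {F : Type u} [NormedAddCommGroup F] [NormedSpace ℝ F] (f : C(E, F)),
      ContDiff ℝ m f → ContDiff ℝ m (fun u : C(K, E) => f.comp u) := by
  induction m with
  | zero =>
    intro F _ _ f _
    exact contDiff_zero.2 (ContinuousMap.continuous_postcomp f)
  | succ m ih =>
    intro F _ _ f hf
    have hf1 : ContDiff ℝ 1 f := hf.of_le (by norm_cast; omega)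
    have hf' : ContDiff ℝ m (fderivMap f hf1) := by
      have := hf
      push_cast at this
      exact (contDiff_succ_iff_fderiv.1 this).2.2
    push_cast
    refine contDiff_succ_iff_hasFDerivAt.2 ⟨_, ?_, fun u => hasFDerivAt_postcomp f hf1 u⟩
    exact (bilinMap K (ContinuousLinearMap.id ℝ (E →L[ℝ] F))).contDiff.comp (ih _ hf')

/-- Postcomposition with a smooth function is a smooth operation on continuous functions on a
compact space. -/
theorem contDiff_postcomp {K : Type*} [TopologicalSpace K] [CompactSpace K] {E F : Type u}
    [NormedAddCommGroup E] [NormedSpace ℝ E] [NormedAddCommGroup F] [NormedSpace ℝ F]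
    (f : C(E, F)) (hf : ContDiff ℝ ∞ f) : ContDiff ℝ ∞ (fun u : C(K, E) => f.comp u) :=
  contDiff_infty.2 fun m => contDiff_postcomp_nat m f (hf.of_le (by exact_mod_cast le_top))

/-! ### Smooth local inverses and the integration operator -/

/-- Inverse function theorem, with a neighbourhood on which the inverse is smooth. -/
theorem exists_smooth_local_inverse {E F : Type*} [NormedAddCommGroup E] [NormedSpace ℝ E]
    [CompleteSpace E] [NormedAddCommGroup F] [NormedSpace ℝ F] {f : E → F} {a : E}
    (hf : ∀ᶠ x in 𝓝 a, ContDiffAt ℝ ∞ f x) (e : E ≃L[ℝ] F)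
    (he : HasFDerivAt f (e : E →L[ℝ] F) a) :
    ∃ g : F → E, g (f a) = a ∧
      ∀ᶠ y in 𝓝 (f a), f (g y) = y ∧ ContDiffAt ℝ ∞ g y := by
  have ha : ContDiffAt ℝ ∞ f a := hf.self_of_nhds
  set Φ := ha.toOpenPartialHomeomorph f he (by simp) with hΦ
  have hΦf : ∀ x, Φ x = f x := fun x => rfl
  have hmem : a ∈ Φ.source := ha.mem_toOpenPartialHomeomorph_source he (by simp)
  have hga : Φ.symm (f a) = a := Φ.left_inv hmem
  have hfa : f a ∈ Φ.target := Φ.map_source hmem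
  have hcont : ContinuousAt Φ.symm (f a) := Φ.continuousAt_symm hfa
  have hinv : ∀ᶠ x in 𝓝 a, fderiv ℝ f x ∈ range ((↑) : (E ≃L[ℝ] F) → E →L[ℝ] F) := by
    have h1 : ContinuousAt (fderiv ℝ f) a :=
      (ha.fderiv_right (m := 0) (by simp)).continuousAt
    apply h1.eventually
    rw [he.fderiv]
    exact ContinuousLinearEquiv.nhds e
  refine ⟨Φ.symm, hga, ?_⟩
  have h2 : ∀ᶠ y in 𝓝 (f a), ContDiffAt ℝ ∞ f (Φ.symm y) ∧
      fderiv ℝ f (Φ.symm y) ∈ range ((↑) : (E ≃L[ℝ] F) → E →L[ℝ] F) := by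
    have := hf.and hinv
    rw [← hga] at this
    exact hcont.eventually this
  filter_upwards [h2, Φ.open_target.mem_nhds hfa] with y ⟨hy, e', he'⟩ hyt
  refine ⟨Φ.right_inv hyt, Φ.contDiffAt_symm (f₀' := e') hyt ?_ hy⟩
  rw [he']
  exact (hy.differentiableAt (by simp)).hasFDerivAt

/-- Integration from `0`, as an operator on continuous functions on the unit interval. -/
noncomputable def integralMap : C(unitInterval, ℝ) →L[ℝ] C(unitInterval, ℝ) :=
  LinearMap.mkContinuous
    { toFun := fun u => ⟨fun s => ∫ r in (0 : ℝ)..s, IccExtend zero_le_one u r, by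
        have : Continuous (fun s : ℝ => ∫ r in (0 : ℝ)..s, IccExtend zero_le_one u r) :=
          intervalIntegral.continuous_primitive
            (fun a b => (u.continuous.Icc_extend' (h := zero_le_one)).intervalIntegrable a b) 0
        exact this.comp continuous_subtype_val⟩
      map_add' := fun u w => by
        ext s
        exact intervalIntegral.integral_add
          ((u.continuous.Icc_extend' (h := zero_le_one)).intervalIntegrable _ _)
          ((w.continuous.Icc_extend' (h := zero_le_one)).intervalIntegrable _ _)
      map_smul' := fun c u => by
        ext s
        exact intervalIntegral.integral_const_mul c _ } 1
    (fun u => by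
      refine (ContinuousMap.norm_le _ (by positivity)).2 fun s => ?_
      have h := intervalIntegral.norm_integral_le_of_norm_le_const (a := (0 : ℝ)) (b := s)
        (f := IccExtend zero_le_one u) (C := ‖u‖) (fun x _ => u.norm_coe_le_norm _)
      refine h.trans ?_
      rw [sub_zero, abs_of_nonneg s.2.1, one_mul]
      exact mul_le_of_le_one_right (norm_nonneg _) s.2.2)

theorem integralMap_apply (u : C(unitInterval, ℝ)) (s : unitInterval) :
    integralMap u s = ∫ r in (0 : ℝ)..s, IccExtend zero_le_one u r := rfl

/-- Only the right derivative is claimed, since the extension is constant to the left of `0`; the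
Grönwall argument needs no more. -/
theorem hasDerivWithinAt_integralMap (u : C(unitInterval, ℝ)) (s : ℝ) (hs : s ∈ Ico (0 : ℝ) 1) :
    HasDerivWithinAt (IccExtend zero_le_one (integralMap u)) (IccExtend zero_le_one u s)
      (Ici s) s := by
  have hc : Continuous (IccExtend (zero_le_one (α := ℝ)) u) := u.continuous.Icc_extend'
  have h := (hc.integral_hasStrictDerivAt 0 s).hasDerivAt.hasDerivWithinAt (s := Ici s)
  refine h.congr_of_eventuallyEq ?_ ?_
  · have : Iio (1 : ℝ) ∈ 𝓝[Ici s] s := mem_nhdsWithin_of_mem_nhds (Iio_mem_nhds hs.2)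
    filter_upwards [self_mem_nhdsWithin, this] with r hr hr1
    rw [IccExtend_of_mem _ _ ⟨hs.1.trans hr, le_of_lt hr1⟩, integralMap_apply]
  · rw [IccExtend_of_mem _ _ ⟨hs.1, hs.2.le⟩, integralMap_apply]

/-! ### The differential equation along rays -/

section Rays

open unitInterval

set_option synthInstance.maxHeartbeats 400000

variable {E : Type u} [NormedAddCommGroup E] [NormedSpace ℝ E]

/-- The linear part of the path `s ↦ (x₀ + s ξ, y s)` in `E × ℝ`. -/
noncomputable def rayLin : E × C(I, ℝ) →L[ℝ] C(I, E × ℝ) :=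
  ((ContinuousLinearMap.inl ℝ E ℝ).compLeftContinuous ℝ I ∘L
    (bilinMap I (ContinuousLinearMap.lsmul ℝ ℝ) ⟨Subtype.val, continuous_subtype_val⟩ ∘L
      constMap I E)).coprod ((ContinuousLinearMap.inr ℝ E ℝ).compLeftContinuous ℝ I)

@[simp] lemma rayLin_apply (p : E × C(I, ℝ)) (s : I) :
    rayLin p s = ((s : ℝ) • p.1, p.2 s) := by
  simp [rayLin]

/-- The path `s ↦ (x₀ + s ξ, y s)` in `E × ℝ`. -/
noncomputable def ray (x₀ : E) (p : E × C(I, ℝ)) : C(I, E × ℝ) :=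
  constMap I (E × ℝ) (x₀, 0) + rayLin p

@[simp] lemma ray_apply (x₀ : E) (p : E × C(I, ℝ)) (s : I) :
    ray x₀ p s = (x₀ + (s : ℝ) • p.1, p.2 s) := by
  simp [ray]

/-- The integral operator of the ordinary differential equation `y' = a (x₀ + s ξ, y) ξ`. -/
noncomputable def rayIntegral (a : C(E × ℝ, E →L[ℝ] ℝ)) (x₀ : E) (p : E × C(I, ℝ)) : C(I, ℝ) :=
  integralMap (bilinMap I (ContinuousLinearMap.id ℝ (E →L[ℝ] ℝ)) (a.comp (ray x₀ p))
    (constMap I E p.1))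

theorem contDiff_ray (x₀ : E) : ContDiff ℝ ∞ (ray x₀) :=
  contDiff_const.add (rayLin (E := E)).contDiff

theorem contDiff_rayIntegral {a : C(E × ℝ, E →L[ℝ] ℝ)} (ha : ContDiff ℝ ∞ a) (x₀ : E) :
    ContDiff ℝ ∞ (rayIntegral a x₀) := by
  refine integralMap.contDiff.comp ?_
  exact (bilinMap I (ContinuousLinearMap.id ℝ (E →L[ℝ] ℝ))).isBoundedBilinearMap.contDiff.comp
    (((contDiff_postcomp a ha).comp (contDiff_ray x₀)).prodMk
      ((constMap I E).contDiff.comp contDiff_fst))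

-- Product rule: `ξ` occurs both as the argument of `a` and inside the ray, hence two terms.
set_option maxHeartbeats 400000 in
theorem fderiv_rayIntegral {a : C(E × ℝ, E →L[ℝ] ℝ)} (ha : ContDiff ℝ ∞ a) (x₀ : E)
    (p q : E × C(I, ℝ)) :
    fderiv ℝ (rayIntegral a x₀) p q =
      integralMap (bilinMap I (ContinuousLinearMap.id ℝ (E →L[ℝ] ℝ)) (a.comp (ray x₀ p))
          (constMap I E q.1) +
        bilinMap I (ContinuousLinearMap.id ℝ (E →L[ℝ] ℝ))
          (postcompDeriv a (ha.of_le (by simp)) (ray x₀ p) (rayLin q))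
          (constMap I E p.1)) := by
  obtain ⟨D, hD, hDq⟩ := hasFDerivAt_apply_postcomp a (ha.of_le (by simp))
    (constMap I (E × ℝ) (x₀, 0)) rayLin (constMap I E ∘L ContinuousLinearMap.fst ℝ E C(I, ℝ)) p
  have h5 : fderiv ℝ (rayIntegral a x₀) p = integralMap ∘L D :=
    (integralMap.hasFDerivAt.comp p hD).fderiv
  rw [h5, ContinuousLinearMap.comp_apply, hDq]
  rfl

/-- The solutions of `y' = a (x₀ + s ξ, y) ξ`, `y 0 = w`, exist on the unit interval and depend
smoothly on `(ξ, w)` for `ξ` close to zero. -/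
theorem exists_ray_solution [CompleteSpace E] {a : C(E × ℝ, E →L[ℝ] ℝ)} (ha : ContDiff ℝ ∞ a)
    (x₀ : E) (v₀ : ℝ) :
    ∃ Y : E × ℝ → C(I, ℝ), Y (0, v₀) = constMap I ℝ v₀ ∧
      ∀ᶠ z in 𝓝 ((0, v₀) : E × ℝ), ContDiffAt ℝ ∞ Y z ∧
        Y z = constMap I ℝ z.2 + rayIntegral a x₀ (z.1, Y z) := by
  -- `Φ` keeps the parameters `(ξ, w)` and records the defect of the integral equation; a solution
  -- is a point with zero defect.
  let Φ : (E × ℝ) × C(I, ℝ) → (E × ℝ) × C(I, ℝ) := fun p =>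
    (p.1, p.2 - (constMap I ℝ p.1.2 + rayIntegral a x₀ (p.1.1, p.2)))
  let p₀ : (E × ℝ) × C(I, ℝ) := ((0, v₀), constMap I ℝ v₀)
  have hΦ : ContDiff ℝ ∞ Φ := by
    refine contDiff_fst.prodMk (contDiff_snd.sub (((constMap I ℝ).contDiff.comp
      (contDiff_snd.comp contDiff_fst)).add ((contDiff_rayIntegral ha x₀).comp
      ((contDiff_fst.comp contDiff_fst).prodMk contDiff_snd))))
  have hint0 : ∀ y, rayIntegral a x₀ (0, y) = 0 := fun y => by
    simp [rayIntegral]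
  have hΦ₀ : Φ p₀ = ((0, v₀), 0) := by
    simp [Φ, p₀, hint0]
  -- At `ξ = 0` the integral operator does not depend on `y`, so the derivative of `Φ` is block
  -- triangular with identities on the diagonal, hence invertible.
  let T : E × ℝ →L[ℝ] C(I, ℝ) := -(constMap I ℝ ∘L ContinuousLinearMap.snd ℝ E ℝ +
    fderiv ℝ (rayIntegral a x₀) (0, constMap I ℝ v₀) ∘L
      ContinuousLinearMap.inl ℝ E C(I, ℝ) ∘L ContinuousLinearMap.fst ℝ E ℝ)
  let e : ((E × ℝ) × C(I, ℝ)) ≃L[ℝ] ((E × ℝ) × C(I, ℝ)) :=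
    (ContinuousLinearEquiv.refl ℝ (E × ℝ)).skewProd (ContinuousLinearEquiv.refl ℝ C(I, ℝ)) T
  have hR : HasFDerivAt (rayIntegral a x₀) (fderiv ℝ (rayIntegral a x₀) (0, constMap I ℝ v₀))
      (0, constMap I ℝ v₀) :=
    ((contDiff_rayIntegral ha x₀).differentiable (by simp) _).hasFDerivAt
  have hpair : HasFDerivAt (fun p : (E × ℝ) × C(I, ℝ) => (p.1.1, p.2))
      (((ContinuousLinearMap.fst ℝ E ℝ) ∘L ContinuousLinearMap.fst ℝ (E × ℝ) C(I, ℝ)).prod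
        (ContinuousLinearMap.snd ℝ (E × ℝ) C(I, ℝ))) p₀ :=
    (hasFDerivAt_fst.comp p₀ hasFDerivAt_fst).prodMk hasFDerivAt_snd
  have hconst : HasFDerivAt (fun p : (E × ℝ) × C(I, ℝ) => constMap I ℝ p.1.2)
      (constMap I ℝ ∘L ContinuousLinearMap.snd ℝ E ℝ ∘L
        ContinuousLinearMap.fst ℝ (E × ℝ) C(I, ℝ)) p₀ :=
    (constMap I ℝ).hasFDerivAt.comp p₀ (hasFDerivAt_snd.comp p₀ hasFDerivAt_fst)
  have hzero : ∀ y, fderiv ℝ (rayIntegral a x₀) (0, constMap I ℝ v₀) (0, y) = 0 := fun y => by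
    rw [fderiv_rayIntegral ha]
    simp
  have he : HasFDerivAt Φ (e : ((E × ℝ) × C(I, ℝ)) →L[ℝ] ((E × ℝ) × C(I, ℝ))) p₀ := by
    have hmain := (hasFDerivAt_fst (𝕜 := ℝ) (p := p₀)).prodMk
      ((hasFDerivAt_snd (𝕜 := ℝ) (p := p₀)).sub (hconst.add (hR.comp p₀ hpair)))
    refine hmain.congr_fderiv ?_
    refine ContinuousLinearMap.ext fun p => ?_
    obtain ⟨⟨ξ, w⟩, y⟩ := p
    refine Prod.ext rfl ?_
    have hsplit : fderiv ℝ (rayIntegral a x₀) (0, constMap I ℝ v₀) (ξ, y) =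
        fderiv ℝ (rayIntegral a x₀) (0, constMap I ℝ v₀) (ξ, 0) := by
      have : ((ξ, y) : E × C(I, ℝ)) = (ξ, 0) + (0, y) := by simp
      rw [this, map_add, hzero, add_zero]
    change y - (constMap I ℝ w + fderiv ℝ (rayIntegral a x₀) (0, constMap I ℝ v₀) (ξ, y)) =
      y + -(constMap I ℝ w + fderiv ℝ (rayIntegral a x₀) (0, constMap I ℝ v₀) (ξ, 0))
    rw [hsplit, sub_eq_add_neg]
  obtain ⟨g, hg₀, hg⟩ := exists_smooth_local_inverse
    (Eventually.of_forall fun p => hΦ.contDiffAt) e he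
  rw [hΦ₀] at hg₀ hg
  refine ⟨fun z => (g (z, 0)).2, by simp [hg₀, p₀], ?_⟩
  have hcont : ContinuousAt (fun z : E × ℝ => (z, (0 : C(I, ℝ)))) (0, v₀) := by fun_prop
  filter_upwards [hcont.eventually hg] with z ⟨hz, hz'⟩
  refine ⟨contDiffAt_snd.comp z (hz'.comp z (contDiffAt_id.prodMk contDiffAt_const)), ?_⟩
  have h1 : (g (z, 0)).1 = z := congrArg Prod.fst hz
  have h2 : (g (z, 0)).2 - (constMap I ℝ (g (z, 0)).1.2 +
    rayIntegral a x₀ ((g (z, 0)).1.1, (g (z, 0)).2)) = 0 := congrArg Prod.snd hz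
  rw [h1] at h2
  exact sub_eq_zero.1 h2

end Rays

/-! ### The Frobenius theorem in a vector space -/

section Variation

open unitInterval

variable {E : Type u} [NormedAddCommGroup E] [NormedSpace ℝ E]

set_option synthInstance.maxHeartbeats 400000
set_option maxHeartbeats 400000

/-- The variation of the solution of `y' = a (x₀ + s ξ, y) ξ` with respect to `ξ` is
`s ↦ s a (x₀ + s ξ, y)`, provided that the form `dv - a dx` is integrable. -/
theorem ray_variation {a : C(E × ℝ, E →L[ℝ] ℝ)} (ha : ContDiff ℝ ∞ a) {x₀ ξ η : E} {w : ℝ}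
    {y z : C(I, ℝ)} (hy : y = constMap I ℝ w + rayIntegral a x₀ (ξ, y))
    (hz : z = fderiv ℝ (rayIntegral a x₀) (ξ, y) (η, z))
    (hint : ∀ s : I, fderiv ℝ a (ray x₀ (ξ, y) s) (ξ, a (ray x₀ (ξ, y) s) ξ) η =
      fderiv ℝ a (ray x₀ (ξ, y) s) (η, a (ray x₀ (ξ, y) s) η) ξ) (s : I) :
    z s = s * a (ray x₀ (ξ, y) s) η := by
  let ye : ℝ → ℝ := IccExtend zero_le_one y
  let ze : ℝ → ℝ := IccExtend zero_le_one z
  let P : ℝ → E × ℝ := fun s => (x₀ + s • ξ, ye s)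
  have hyc : Continuous ye := y.continuous.Icc_extend'
  have hzc : Continuous ze := z.continuous.Icc_extend'
  have hPc : Continuous P := by fun_prop
  have hye : ∀ s : I, ye s = y s := fun s => IccExtend_val _ _ s
  have hze : ∀ s : I, ze s = z s := fun s => IccExtend_val _ _ s
  have hP : ∀ s : I, P s = ray x₀ (ξ, y) s := fun s => by simp [P, hye]
  have hyd : ∀ s (hs : s ∈ Ico (0 : ℝ) 1), HasDerivWithinAt ye (a (P s) ξ) (Ici s) s := by
    intro s hs
    let s' : I := ⟨s, hs.1, hs.2.le⟩
    have h := (hasDerivWithinAt_integralMap (bilinMap I (ContinuousLinearMap.id ℝ (E →L[ℝ] ℝ))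
      (a.comp (ray x₀ (ξ, y))) (constMap I E ξ)) s hs).const_add w
    rw [IccExtend_of_mem _ _ ⟨hs.1, hs.2.le⟩] at h
    rw [show P s = ray x₀ (ξ, y) s' from hP s']
    refine h.congr_of_mem (fun r _ => ?_) self_mem_Ici
    change y _ = w + rayIntegral a x₀ (ξ, y) _
    conv_lhs => rw [hy]
    rfl
  have hzd : ∀ s (hs : s ∈ Ico (0 : ℝ) 1), HasDerivWithinAt ze
      (a (P s) η + fderiv ℝ a (P s) (s • η, ze s) ξ) (Ici s) s := by
    intro s hs
    let s' : I := ⟨s, hs.1, hs.2.le⟩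
    obtain ⟨U, hzU, hU⟩ : ∃ U : C(I, ℝ), z = integralMap U ∧ U s' =
        a (ray x₀ (ξ, y) s') η + fderiv ℝ a (ray x₀ (ξ, y) s') ((s' : ℝ) • η, z s') ξ :=
      ⟨_, hz.trans (fderiv_rayIntegral ha x₀ _ _), by simp⟩
    have h := hasDerivWithinAt_integralMap U s hs
    rw [← hzU, IccExtend_of_mem _ _ ⟨hs.1, hs.2.le⟩] at h
    rw [show P s = ray x₀ (ξ, y) s' from hP s', show ze s = z s' from hze s']
    exact h.congr_deriv hU
  have hPd : ∀ s (hs : s ∈ Ico (0 : ℝ) 1), HasDerivWithinAt P (ξ, a (P s) ξ) (Ici s) s := by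
    intro s hs
    have h1 : HasDerivWithinAt (fun s : ℝ => x₀ + s • ξ) ξ (Ici s) s := by
      simpa using (((hasDerivAt_id s).smul_const ξ).const_add x₀).hasDerivWithinAt
    exact h1.prodMk (hyd s hs)
  let f : ℝ → ℝ := fun s => ze s - s * a (P s) η
  let κ : ℝ → ℝ := fun s => fderiv ℝ a (P s) (0, 1) ξ
  have hDa : Continuous (fderiv ℝ a) := ha.continuous_fderiv (by simp)
  have hκ : Continuous κ := ((hDa.comp hPc).clm_apply continuous_const).clm_apply continuous_const
  have haη : Continuous fun s => a (P s) η := (a.continuous.comp hPc).clm_apply continuous_const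
  have hfd : ∀ s ∈ Ico (0 : ℝ) 1, HasDerivWithinAt f (κ s * f s) (Ici s) s := by
    intro s hs
    let s' : I := ⟨s, hs.1, hs.2.le⟩
    have h1 : HasDerivWithinAt (fun s => a (P s)) (fderiv ℝ a (P s) (ξ, a (P s) ξ)) (Ici s) s :=
      (ha.differentiable (by simp) (P s)).hasFDerivAt.comp_hasDerivWithinAt s (hPd s hs)
    have h2 : HasDerivWithinAt (fun s => a (P s) η) (fderiv ℝ a (P s) (ξ, a (P s) ξ) η)
        (Ici s) s := by
      have := h1.clm_apply (hasDerivWithinAt_const s (Ici s) η)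
      simpa using this
    have h3 := (hzd s hs).sub ((hasDerivWithinAt_id s (Ici s)).mul h2)
    refine h3.congr_deriv ?_
    have h4 := hint s'
    rw [← hP s'] at h4
    change fderiv ℝ a (P s) (ξ, a (P s) ξ) η = fderiv ℝ a (P s) (η, a (P s) η) ξ at h4
    have h5 : ((s • η, ze s) : E × ℝ) = s • (η, a (P s) η) + f s • (0, 1) := by
      simp [f]
    rw [h4, h5, map_add, map_smul, map_smul]
    simp only [add_apply, smul_apply, smul_eq_mul, id, κ]
    ring
  obtain ⟨C, hC⟩ := isCompact_Icc.exists_bound_of_continuousOn (s := Icc (0 : ℝ) 1) hκ.continuousOn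
  have hz0 : ze 0 = 0 := by
    have : ze 0 = z 0 := hze 0
    rw [this, hz, fderiv_rayIntegral ha, integralMap_apply]
    simp
  have hf := eq_zero_of_abs_deriv_le_mul_abs_self_of_eq_zero_right (f := f) (K := C)
    (a := 0) (b := 1)
    (by fun_prop) hfd (by simp [f, hz0]) (fun s hs => by
      rw [norm_mul]
      exact mul_le_mul_of_nonneg_right (hC s ⟨hs.1, hs.2.le⟩) (norm_nonneg _)) s s.2
  rw [← hze, ← hP]
  exact sub_eq_zero.1 hf

/-- Frobenius theorem for the form `dv - a dx` on `E × ℝ`, the leaves being graphs over `E`: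
through every point `(x₀, w)` close to `(x₀, v₀)` passes the graph of a solution of
`y' = a (x, y)`, and these solutions depend smoothly on `w`. -/
theorem exists_leaves [CompleteSpace E] {a : C(E × ℝ, E →L[ℝ] ℝ)} (ha : ContDiff ℝ ∞ a)
    {x₀ : E} {v₀ : ℝ}
    (hint : ∀ᶠ q in 𝓝 (x₀, v₀), ∀ ξ η, fderiv ℝ a q (ξ, a q ξ) η = fderiv ℝ a q (η, a q η) ξ) :
    ∃ Y : E × ℝ → ℝ, (∀ᶠ w in 𝓝 v₀, Y (x₀, w) = w) ∧
      ∀ᶠ z in 𝓝 (x₀, v₀), ContDiffAt ℝ ∞ Y z ∧ ∀ η, fderiv ℝ Y z (η, 0) = a (z.1, Y z) η := by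
  obtain ⟨Y, hY₀, hY⟩ := exists_ray_solution ha x₀ v₀
  -- The ray with `ξ = x - x₀` reaches `x` at time `1`, so the leaf function is the solution for `τ
  -- z` evaluated there.
  let τ : E × ℝ → E × ℝ := fun z => z - (x₀, 0)
  have hτ₀ : τ (x₀, v₀) = (0, v₀) := by simp [τ]
  have hτ : Tendsto τ (𝓝 (x₀, v₀)) (𝓝 (0, v₀)) := by
    rw [← hτ₀]; exact (by fun_prop : Continuous τ).continuousAt
  let ev : C(I, ℝ) →L[ℝ] ℝ := ContinuousMap.evalCLM ℝ (1 : I)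
  refine ⟨fun z => ev (Y (τ z)), ?_, ?_⟩
  · have h1 : Tendsto (fun w : ℝ => ((0, w) : E × ℝ)) (𝓝 v₀) (𝓝 (0, v₀)) :=
      (by fun_prop : Continuous fun w : ℝ => ((0, w) : E × ℝ)).continuousAt
    filter_upwards [h1.eventually hY] with w hw
    have h2 : τ (x₀, w) = (0, w) := by simp [τ]
    rw [h2, hw.2]
    simp [ev, rayIntegral]
  have hYc : ContinuousAt Y (0, v₀) := hY.self_of_nhds.1.continuousAt
  have hrayc : ContinuousAt (fun z : E × ℝ => ray x₀ (z.1, Y z)) (0, v₀) :=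
    (contDiff_ray x₀).continuous.continuousAt.comp (continuousAt_fst.prodMk hYc)
  have hray₀ : ray x₀ (0, Y (0, v₀)) = constMap I (E × ℝ) (x₀, v₀) := by
    ext s <;> simp [hY₀]
  obtain ⟨δ, hδ, hball⟩ := Metric.eventually_nhds_iff_ball.1 hint
  -- Integrability is known only near `(x₀, v₀)`; continuity in the sup norm keeps the whole ray in
  -- that region.
  have hnear : ∀ᶠ z in 𝓝 ((0, v₀) : E × ℝ), ∀ s : I,
      ray x₀ (z.1, Y z) s ∈ Metric.ball (x₀, v₀) δ := by
    have := Metric.tendsto_nhds.1 hrayc δ hδ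
    filter_upwards [this] with z hz s
    refine (ContinuousMap.dist_apply_le_dist
      (g := constMap I (E × ℝ) (x₀, v₀)) s).trans_lt ?_
    rw [← hray₀]
    exact hz
  filter_upwards [hτ.eventually (hY.eventually_nhds.and hnear)] with z ⟨hz, hzn⟩
  obtain ⟨hzs, hzY⟩ := hz.self_of_nhds
  have hτs : ContDiff ℝ ∞ τ := contDiff_id.sub contDiff_const
  refine ⟨ev.contDiff.contDiffAt.comp z (hzs.comp z hτs.contDiffAt), fun η => ?_⟩
  have hD := (hzs.differentiableAt (by simp)).hasFDerivAt
  have hτD : HasFDerivAt τ (ContinuousLinearMap.id ℝ (E × ℝ)) z :=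
    (hasFDerivAt_id z).sub_const _
  have h1 : fderiv ℝ (fun z => ev (Y (τ z))) z (η, 0) = ev (fderiv ℝ Y (τ z) (η, 0)) := by
    have : HasFDerivAt (fun z => ev (Y (τ z))) _ z :=
      ev.hasFDerivAt.comp z (hD.comp z hτD)
    rw [this.fderiv]
    rfl
  -- The integral equation, valid near `τ z`, is differentiated in a direction that fixes the
  -- initial value `w`, so the constant term drops out.
  have h2 : fderiv ℝ Y (τ z) (η, 0) = fderiv ℝ (rayIntegral a x₀) ((τ z).1, Y (τ z))
      (η, fderiv ℝ Y (τ z) (η, 0)) := by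
    have h3 := (constMap I ℝ).hasFDerivAt.comp (τ z) (hasFDerivAt_snd (p := τ z) (𝕜 := ℝ) (E := E))
    have h4 := ((contDiff_rayIntegral ha x₀).differentiable (by simp)
      ((τ z).1, Y (τ z))).hasFDerivAt.comp (τ z) (hasFDerivAt_fst.prodMk hD)
    have h5 : HasFDerivAt Y _ (τ z) :=
      (h3.add h4).congr_of_eventuallyEq (hz.mono fun z' hz' => hz'.2)
    conv_lhs => rw [h5.fderiv]
    simp
  have h6 := ray_variation ha hzY h2 (fun s => hball _ (hzn s) _ _) 1
  rw [h1]
  refine h6.trans ?_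
  simp [τ, ev]

/-- Frobenius theorem: a form `dv - a dx` with involutive kernel is, locally, a multiple of the
differential of a function. -/
theorem exists_first_integral [FiniteDimensional ℝ E] {a : E × ℝ → E →L[ℝ] ℝ} {q₀ : E × ℝ}
    (ha : ∀ᶠ q in 𝓝 q₀, ContDiffAt ℝ ∞ a q)
    (hint : ∀ᶠ q in 𝓝 q₀, ∀ ξ η, fderiv ℝ a q (ξ, a q ξ) η = fderiv ℝ a q (η, a q η) ξ) :
    ∃ W : E × ℝ → ℝ, ∀ᶠ q in 𝓝 q₀, ContDiffAt ℝ ∞ W q ∧ fderiv ℝ W q (0, 1) ≠ 0 ∧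
      ∀ h, fderiv ℝ W q h = fderiv ℝ W q (0, 1) * (h.2 - a q h.1) := by
  have : CompleteSpace E := FiniteDimensional.complete ℝ E
  obtain ⟨δ, hδ, hball⟩ := Metric.eventually_nhds_iff_ball.1 ha
  -- A cutoff makes the coefficient globally smooth. Its support stays inside the ball of radius `δ`
  -- where `a` is smooth, and near `q₀` nothing changes.
  let χ : ContDiffBump q₀ := ⟨δ / 3, δ / 2, by positivity, by linarith⟩
  have hsm : ContDiff ℝ ∞ (fun q => χ q • a q) := by
    refine contDiff_iff_contDiffAt.2 fun q => ?_
    by_cases hq : q ∈ Metric.ball q₀ δ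
    · exact χ.contDiff.contDiffAt.smul (hball q hq)
    · have h1 : q ∉ tsupport χ := by
        rw [χ.tsupport_eq]
        intro h
        rw [Metric.mem_closedBall] at h
        rw [Metric.mem_ball] at hq
        change dist q q₀ ≤ δ / 2 at h
        linarith
      refine (contDiffAt_const (c := (0 : E →L[ℝ] ℝ))).congr_of_eventuallyEq ?_
      filter_upwards [notMem_tsupport_iff_eventuallyEq.1 h1] with r hr
      rw [hr]; simp
  let b : C(E × ℝ, E →L[ℝ] ℝ) := ⟨fun q => χ q • a q, hsm.continuous⟩
  have hb : ContDiff ℝ ∞ b := hsm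
  have hba : ∀ᶠ q in 𝓝 q₀, b q = a q := by
    filter_upwards [χ.eventuallyEq_one] with q hq
    change χ q • a q = a q
    rw [hq]; simp
  obtain ⟨x₀, v₀⟩ := q₀
  have hbint : ∀ᶠ q in 𝓝 (x₀, v₀), ∀ ξ η,
      fderiv ℝ b q (ξ, b q ξ) η = fderiv ℝ b q (η, b q η) ξ := by
    filter_upwards [hba.eventually_nhds, hint] with q hq hq' ξ η
    have h1 : fderiv ℝ b q = fderiv ℝ a q := Filter.EventuallyEq.fderiv_eq hq
    rw [h1, hq.self_of_nhds, hq']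
  obtain ⟨Y, hY₀, hY⟩ := exists_leaves hb hbint
  have hYv : Y (x₀, v₀) = v₀ := hY₀.self_of_nhds
  obtain ⟨hYs, hYD⟩ := hY.self_of_nhds
  have hYd := (hYs.differentiableAt (by simp)).hasFDerivAt
  have hYw : fderiv ℝ Y (x₀, v₀) (0, 1) = 1 := by
    have h1 : HasDerivAt (fun w : ℝ => ((x₀, w) : E × ℝ)) (0, 1) v₀ :=
      (hasDerivAt_const v₀ x₀).prodMk (hasDerivAt_id v₀)
    have h2 := hYd.comp_hasDerivAt v₀ h1
    exact h2.unique ((hasDerivAt_id v₀).congr_of_eventuallyEq hY₀)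
  -- `Θ` straightens the leaves; its derivative is triangular because `∂Y/∂w = 1` at the centre. The
  -- first integral is the second component of its inverse.
  let Θ : E × ℝ → E × ℝ := fun z => (z.1, Y z)
  have hΘ₀ : Θ (x₀, v₀) = (x₀, v₀) := by simp [Θ, hYv]
  let e : (E × ℝ) ≃L[ℝ] (E × ℝ) :=
    (ContinuousLinearEquiv.refl ℝ E).skewProd (ContinuousLinearEquiv.refl ℝ ℝ) (b (x₀, v₀))
  have he : HasFDerivAt Θ (e : (E × ℝ) →L[ℝ] (E × ℝ)) (x₀, v₀) := by
    refine (hasFDerivAt_fst.prodMk hYd).congr_fderiv ?_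
    refine ContinuousLinearMap.ext fun p => ?_
    obtain ⟨ξ, r⟩ := p
    refine Prod.ext rfl ?_
    change fderiv ℝ Y (x₀, v₀) (ξ, r) = r + b (x₀, v₀) ξ
    have h1 : ((ξ, r) : E × ℝ) = (ξ, 0) + r • (0, 1) := by simp
    rw [h1, map_add, map_smul, hYw, hYD, hYv, smul_eq_mul, mul_one, add_comm]
  obtain ⟨g, hg₀, hg⟩ := exists_smooth_local_inverse (f := Θ)
    (hY.mono fun z hz => contDiffAt_fst.prodMk hz.1) e he
  rw [hΘ₀] at hg₀ hg
  have hgc : Tendsto g (𝓝 (x₀, v₀)) (𝓝 (x₀, v₀)) := by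
    conv_rhs => rw [← hg₀]
    exact hg.self_of_nhds.2.continuousAt
  refine ⟨fun q => (g q).2, ?_⟩
  filter_upwards [hg.eventually_nhds, hgc.eventually hY, hba] with q hq hqY hqb
  obtain ⟨hΘg, hgs⟩ := hq.self_of_nhds
  have hgd := (hgs.differentiableAt (by simp)).hasFDerivAt
  have hWd : HasFDerivAt (fun q => (g q).2) (ContinuousLinearMap.snd ℝ E ℝ ∘L fderiv ℝ g q) q :=
    hasFDerivAt_snd.comp q hgd
  have hYgd := ((hqY.1.differentiableAt (by simp)).hasFDerivAt).comp q hgd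
  have h1 : ∀ h, (fderiv ℝ g q h).1 = h.1 := by
    intro h
    have h2 : HasFDerivAt (fun q => (g q).1) (ContinuousLinearMap.fst ℝ E ℝ ∘L fderiv ℝ g q) q :=
      hasFDerivAt_fst.comp q hgd
    have h3 : HasFDerivAt (fun q => (g q).1) (ContinuousLinearMap.fst ℝ E ℝ) q :=
      hasFDerivAt_fst.congr_of_eventuallyEq (hq.mono fun r hr => by
        have := congrArg Prod.fst hr.1
        exact this)
    exact congrArg (fun L : E × ℝ →L[ℝ] E => L h) (h2.unique h3)
  have h4 : ∀ h, fderiv ℝ Y (g q) (fderiv ℝ g q h) = h.2 := by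
    intro h
    have h3 : HasFDerivAt (Y ∘ g) (ContinuousLinearMap.snd ℝ E ℝ) q :=
      hasFDerivAt_snd.congr_of_eventuallyEq (hq.mono fun r hr => congrArg Prod.snd hr.1)
    exact congrArg (fun L : E × ℝ →L[ℝ] ℝ => L h) (hYgd.unique h3)
  -- Differentiating `Y (g q) = q.2` along `h`: the leaf equation supplies `a q h.1`, and the rest
  -- is `∂Y/∂w` times `dW(h)`.
  have h5 : ∀ h, (fderiv ℝ g q h).2 * fderiv ℝ Y (g q) (0, 1) = h.2 - a q h.1 := by
    intro h
    have h6 : fderiv ℝ g q h = (h.1, 0) + (fderiv ℝ g q h).2 • (0, 1) := by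
      refine Prod.ext ?_ ?_ <;> simp [h1]
    have h7 := h4 h
    rw [h6, map_add, map_smul, hqY.2] at h7
    have h8 : ((g q).1, Y (g q)) = q := hΘg
    rw [h8, hqb, smul_eq_mul] at h7
    linarith
  have h9 : (fderiv ℝ g q (0, 1)).2 * fderiv ℝ Y (g q) (0, 1) = 1 := by
    rw [h5]; simp
  rw [hWd.fderiv]
  refine ⟨contDiffAt_snd.comp q hgs, left_ne_zero_of_mul_eq_one h9, fun h => ?_⟩
  change (fderiv ℝ g q h).2 = (fderiv ℝ g q (0, 1)).2 * (h.2 - a q h.1)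
  rw [← h5 h, mul_left_comm, h9, mul_one]

end Variation

theorem natCast_le_infty (m : ℕ) : (m : WithTop ℕ∞) ≤ ∞ := mod_cast le_top

open VectorField

/-! ### Forms, functions and vector fields in charts -/

section Charts

variable {E : Type*} [NormedAddCommGroup E] [NormedSpace ℝ E] {H : Type*} [TopologicalSpace H]
  {I : ModelWithCorners ℝ E H} {N : Type*} [TopologicalSpace N] [ChartedSpace H N]

/-- The expression of a 1-form in the chart at `x₀`. -/
noncomputable def chartForm (I : ModelWithCorners ℝ E H) (x₀ : N)
    (θ : ∀ x : N, TangentSpace I x →L[ℝ] ℝ) (x : N) : E →L[ℝ] ℝ :=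
  θ x ∘L (mfderiv% (extChartAt I x₀) x).inverse

section Forms

variable [IsManifold I 1 N]

theorem mfderiv_symm_eq_inverse {x₀ x : N} (hx : x ∈ (extChartAt I x₀).source) :
    mfderiv[range I] (extChartAt I x₀).symm (extChartAt I x₀ x) =
      (mfderiv% (extChartAt I x₀) x).inverse :=
  (ContinuousLinearMap.inverse_eq (mfderiv_extChartAt_comp_mfderivWithin_extChartAt_symm' hx)
    (mfderivWithin_extChartAt_symm_comp_mfderiv_extChartAt' hx)).symm

theorem chartForm_mfderiv {x₀ x : N} (hx : x ∈ (extChartAt I x₀).source)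
    (θ : ∀ x : N, TangentSpace I x →L[ℝ] ℝ) (v : TangentSpace I x) :
    chartForm I x₀ θ x (mfderiv% (extChartAt I x₀) x v) = θ x v := by
  refine congrArg (θ x) ?_
  exact ((isInvertible_mfderiv_extChartAt hx).inverse_apply_eq).2 rfl

theorem mpullbackWithin_symm_apply {x₀ : N} {y : E} (hy : y ∈ (extChartAt I x₀).target)
    (X : ∀ x : N, TangentSpace I x) :
    mpullbackWithin 𝓘(ℝ, E) I (extChartAt I x₀).symm X (range I) y =
      mfderiv% (extChartAt I x₀) ((extChartAt I x₀).symm y) (X ((extChartAt I x₀).symm y)) := by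
  rw [mpullbackWithin_apply, ContinuousLinearMap.inverse_eq
    (mfderivWithin_extChartAt_symm_comp_mfderiv_extChartAt hy)
    (mfderiv_extChartAt_comp_mfderivWithin_extChartAt_symm hy)]
  rfl

end Forms

/-- The trivialization of the cotangent bundle at `x₀` is precomposition with the inverse of the
derivative of the chart. -/
theorem contMDiffOn_form_iff [IsManifold I ∞ N] {θ : ∀ x : N, TangentSpace I x →L[ℝ] ℝ}
    {x₀ : N} {O : Set N} (hO : IsOpen O) (hO' : O ⊆ (extChartAt I x₀).source) :
    ContMDiffOn I (I.prod 𝓘(ℝ, E →L[ℝ] ℝ)) ∞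
      (fun x => (⟨x, θ x⟩ : Bundle.TotalSpace (E →L[ℝ] ℝ)
        (fun x : N => TangentSpace I x →L[ℝ] Bundle.Trivial N ℝ x))) O ↔
    ContMDiffOn I 𝓘(ℝ, E →L[ℝ] ℝ) ∞ (chartForm I x₀ θ) O := by
  have : IsManifold I (∞ + 1) N := by simpa
  have : IsManifold I 1 N := .of_le (n := ∞) (by simp)
  have hb : ∀ x ∈ O, x ∈ (chartAt H x₀).source := fun x hx => by
    simpa using hO' hx
  have h1 := (trivializationAt (E →L[ℝ] ℝ)
    (fun x : N => TangentSpace I x →L[ℝ] Bundle.Trivial N ℝ x) x₀).contMDiffOn_section_iff (IB := I)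
    (n := ∞) (s := θ) hO (fun x hx => by simpa using hb x hx)
  refine h1.trans ?_
  refine contMDiffOn_congr fun x hx => ?_
  rw [hom_trivializationAt_apply]
  change _ ∘L (θ x ∘L _) = _
  rw [TangentBundle.symmL_trivializationAt (hb x hx), mfderiv_symm_eq_inverse (hO' hx)]
  refine ContinuousLinearMap.ext fun v => ?_
  change (Bundle.Trivial.trivialization N ℝ).continuousLinearMapAt ℝ x _ = _
  rw [Bundle.Trivial.continuousLinearMapAt_trivialization]
  rfl

section Functions

variable [I.Boundaryless] [IsManifold I ∞ N]

theorem contDiffAt_comp_chart_symm {F : Type*} [NormedAddCommGroup F] [NormedSpace ℝ F]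
    {f : N → F} {x₀ x : N} (hx : x ∈ (extChartAt I x₀).source)
    (hf : ContMDiffAt I 𝓘(ℝ, F) ∞ f x) :
    ContDiffAt ℝ ∞ (f ∘ (extChartAt I x₀).symm) (extChartAt I x₀ x) := by
  rw [← contMDiffAt_iff_contDiffAt]
  have h1 : ContMDiffAt 𝓘(ℝ, E) I ∞ (extChartAt I x₀).symm (extChartAt I x₀ x) :=
    (contMDiffOn_extChartAt_symm x₀).contMDiffAt
      ((isOpen_extChartAt_target x₀).mem_nhds ((extChartAt I x₀).map_source hx))
  refine ContMDiffAt.comp _ ?_ h1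
  rwa [(extChartAt I x₀).left_inv hx]

theorem mfderiv_eq_fderiv_chart {W : N → ℝ} {x₀ x : N} (hx : x ∈ (extChartAt I x₀).source)
    (hW : ContMDiffAt I 𝓘(ℝ, ℝ) ∞ W x) :
    mfderiv I 𝓘(ℝ, ℝ) W x =
      fderiv ℝ (W ∘ (extChartAt I x₀).symm) (extChartAt I x₀ x) ∘L
        mfderiv% (extChartAt I x₀) x := by
  have : IsManifold I 1 N := .of_le (n := ∞) (by simp)
  have h1 : W =ᶠ[𝓝 x] (W ∘ (extChartAt I x₀).symm) ∘ extChartAt I x₀ := by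
    filter_upwards [extChartAt_source_mem_nhds' hx] with y hy
    exact congrArg W ((extChartAt I x₀).left_inv hy).symm
  have h2 := (contDiffAt_comp_chart_symm hx hW).differentiableAt (by simp)
  rw [h1.mfderiv_eq, mfderiv_comp x h2.mdifferentiableAt
    (mdifferentiableAt_extChartAt (by simpa using hx)), mfderiv_eq_fderiv]
  rfl

theorem contMDiffOn_mfderiv {W : N → ℝ} {O : Set N} (hO : IsOpen O)
    (hW : ContMDiffOn I 𝓘(ℝ, ℝ) ∞ W O) :
    ContMDiffOn I (I.prod 𝓘(ℝ, E →L[ℝ] ℝ)) ∞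
      (fun x => (⟨x, mfderiv I 𝓘(ℝ, ℝ) W x⟩ : Bundle.TotalSpace (E →L[ℝ] ℝ)
        (fun x : N => TangentSpace I x →L[ℝ] Bundle.Trivial N ℝ x))) O := by
  have : IsManifold I 1 N := .of_le (n := ∞) (by simp)
  intro x₀ hx₀
  have hO' := hO.inter (isOpen_extChartAt_source (I := I) x₀)
  have key : ContMDiffOn I 𝓘(ℝ, E →L[ℝ] ℝ) ∞
      (chartForm I x₀ fun x => mfderiv I 𝓘(ℝ, ℝ) W x) (O ∩ (extChartAt I x₀).source) := by
    have h1 : ContMDiffOn I 𝓘(ℝ, E →L[ℝ] ℝ) ∞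
        (fderiv ℝ (W ∘ (extChartAt I x₀).symm) ∘ extChartAt I x₀)
        (O ∩ (extChartAt I x₀).source) := by
      intro x hx
      have h2 := contDiffAt_comp_chart_symm hx.2 (hW.contMDiffAt (hO.mem_nhds hx.1))
      refine (ContMDiffAt.comp x (h2.fderiv_right (m := ∞) (by simp)).contMDiffAt
        (contMDiffAt_extChartAt' (by simpa using hx.2))).contMDiffWithinAt
    refine h1.congr fun x hx => ?_
    refine ContinuousLinearMap.ext fun v => ?_
    obtain ⟨w, rfl⟩ : ∃ w, mfderiv% (extChartAt I x₀) x w = v :=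
      ⟨_, (((isInvertible_mfderiv_extChartAt hx.2).inverse_apply_eq).1 rfl).symm⟩
    refine (chartForm_mfderiv hx.2 (fun x => mfderiv I 𝓘(ℝ, ℝ) W x) w).trans ?_
    rw [mfderiv_eq_fderiv_chart hx.2 (hW.contMDiffAt (hO.mem_nhds hx.1))]
    rfl
  have h2 := (contMDiffOn_form_iff hO' inter_subset_right).2 key
  exact (h2.contMDiffAt (hO'.mem_nhds ⟨hx₀, mem_extChartAt_source x₀⟩)).contMDiffWithinAt

/-- The kernel of the differential of a function is involutive. -/
theorem mfderiv_mlieBracket_eq_zero [CompleteSpace E] {W : N → ℝ} {O : Set N} (hO : IsOpen O)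
    (hW : ContMDiffOn I 𝓘(ℝ, ℝ) ∞ W O) {X Y : ∀ x : N, TangentSpace I x} {x : N} (hx : x ∈ O)
    (hX : MDiffAt (T% X) x) (hY : MDiffAt (T% Y) x)
    (hWX : ∀ y ∈ O, mfderiv I 𝓘(ℝ, ℝ) W y (X y) = 0)
    (hWY : ∀ y ∈ O, mfderiv I 𝓘(ℝ, ℝ) W y (Y y) = 0) :
    mfderiv I 𝓘(ℝ, ℝ) W x (mlieBracket I X Y x) = 0 := by
  have : IsManifold I 1 N := .of_le (n := ∞) (by simp)
  have : IsManifold I 2 N := .of_le (n := ∞) (natCast_le_infty 2)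
  have hWx := hW.contMDiffAt (hO.mem_nhds hx)
  have hxs := mem_extChartAt_source (I := I) x
  let X' : E → E := mpullbackWithin 𝓘(ℝ, E) I (extChartAt I x).symm X (range I)
  let Y' : E → E := mpullbackWithin 𝓘(ℝ, E) I (extChartAt I x).symm Y (range I)
  have hX' : DifferentiableAt ℝ X' (extChartAt I x x) := by
    have := MDifferentiableWithinAt.differentiableWithinAt_mpullbackWithin_vectorField
      (s := univ) hX.mdifferentiableWithinAt
    rw [preimage_univ, univ_inter] at this
    exact this.differentiableAt (by rw [I.range_eq_univ]; exact univ_mem)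
  have hY' : DifferentiableAt ℝ Y' (extChartAt I x x) := by
    have := MDifferentiableWithinAt.differentiableWithinAt_mpullbackWithin_vectorField
      (s := univ) hY.mdifferentiableWithinAt
    rw [preimage_univ, univ_inter] at this
    exact this.differentiableAt (by rw [I.range_eq_univ]; exact univ_mem)
  have hbr : mlieBracket I X Y x =
      (mfderiv% (extChartAt I x) x).inverse (lieBracket (E := E) ℝ X' Y' (extChartAt I x x)) := by
    rw [← mlieBracketWithin_univ, mlieBracketWithin_apply]
    rw [preimage_univ, univ_inter, ← lieBracketWithin_univ, ← I.range_eq_univ]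
  have hzero : ∀ Z : ∀ x : N, TangentSpace I x, (∀ y ∈ O, mfderiv I 𝓘(ℝ, ℝ) W y (Z y) = 0) →
      (fun y => fderiv ℝ (W ∘ (extChartAt I x).symm) y
        (mpullbackWithin 𝓘(ℝ, E) I (extChartAt I x).symm Z (range I) y))
        =ᶠ[𝓝 (extChartAt I x x)] fun _ => 0 := by
    intro Z hZ
    have h1 : ∀ᶠ y in 𝓝 (extChartAt I x x), (extChartAt I x).symm y ∈ O :=
      (continuousAt_extChartAt_symm x).eventually
        (by rw [extChartAt_to_inv]; exact hO.mem_nhds hx)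
    filter_upwards [h1, (isOpen_extChartAt_target x).mem_nhds (mem_extChartAt_target x)]
      with y hyO hy
    have h2 := mfderiv_eq_fderiv_chart ((extChartAt I x).map_target hy)
      (hW.contMDiffAt (hO.mem_nhds hyO))
    have h3 := hZ _ hyO
    rw [h2, (extChartAt I x).right_inv hy] at h3
    rw [mpullbackWithin_symm_apply hy]
    exact h3
  rw [hbr, mfderiv_eq_fderiv_chart hxs hWx]
  have h4 : mfderiv% (extChartAt I x) x ((mfderiv% (extChartAt I x) x).inverse
      (lieBracket (E := E) ℝ X' Y' (extChartAt I x x))) =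
        lieBracket (E := E) ℝ X' Y' (extChartAt I x x) :=
    (((isInvertible_mfderiv_extChartAt hxs).inverse_apply_eq).1 rfl).symm
  refine (congrArg (fderiv ℝ (W ∘ (extChartAt I x).symm) (extChartAt I x x)) h4).trans ?_
  -- By symmetry of the second derivative, `dW` on the bracket is a difference of derivatives of the
  -- functions `dW(X)` and `dW(Y)`, both zero near the point.
  rw [fderiv_apply_lieBracket (n := ∞) (contDiffAt_comp_chart_symm hxs hWx)
    (by simpa using natCast_le_infty 2) hY' hX', (hzero X hWX).fderiv_eq, (hzero Y hWY).fderiv_eq]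
  simp
  rfl

end Functions

section VectorFields

variable [CompleteSpace E] [IsManifold I ∞ N]

/-- Vector fields given in a chart define vector fields on the manifold. -/
theorem contMDiffOn_mpullback_chart {x₀ : N} {O : Set N}
    (hO : O ⊆ (extChartAt I x₀).source) {X : E → E}
    (hX : ∀ x ∈ O, ContDiffAt ℝ ∞ X (extChartAt I x₀ x)) :
    ContMDiffOn I I.tangent ∞ (T% (mpullback I 𝓘(ℝ, E) (extChartAt I x₀) X)) O := by
  intro x hx
  have : IsManifold I 1 N := .of_le (n := ∞) (by simp)
  have : IsManifold I (∞ + 1) N := by simpa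
  refine (ContMDiffAt.mpullback_vectorField_preimage (n := ∞) ?_
    (contMDiffAt_extChartAt' (by simpa using hO hx))
    (isInvertible_mfderiv_extChartAt (hO hx)) (by simp)).contMDiffWithinAt
  exact contMDiffAt_vectorSpace_iff_contDiffAt.2 (hX x hx)

theorem mlieBracket_mpullback_chart {x₀ x : N}
    (hx : x ∈ (extChartAt I x₀).source) {X Y : E → E}
    (hX : ContDiffAt ℝ ∞ X (extChartAt I x₀ x)) (hY : ContDiffAt ℝ ∞ Y (extChartAt I x₀ x)) :
    mlieBracket I (mpullback I 𝓘(ℝ, E) (extChartAt I x₀) X)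
        (mpullback I 𝓘(ℝ, E) (extChartAt I x₀) Y) x =
      (mfderiv% (extChartAt I x₀) x).inverse (lieBracket (E := E) ℝ X Y (extChartAt I x₀ x)) := by
  have : IsManifold I (minSmoothness ℝ 3) N := .of_le (n := ∞) (by simpa using natCast_le_infty 3)
  have h := mpullback_mlieBracket (I := I) (I' := 𝓘(ℝ, E)) (n := ∞) (f := extChartAt I x₀)
    (V := X) (W := Y) (x₀ := x)
    ((contMDiffAt_vectorSpace_iff_contDiffAt.2 hX).mdifferentiableAt (by simp))
    ((contMDiffAt_vectorSpace_iff_contDiffAt.2 hY).mdifferentiableAt (by simp))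
    (contMDiffAt_extChartAt' (by simpa using hx)) (by simpa using natCast_le_infty 2)
  rw [← h, mpullback_apply]
  refine congrArg (mfderiv% (extChartAt I x₀) x).inverse ?_
  have h1 := mlieBracketWithin_eq_lieBracketWithin (𝕜 := ℝ) (E := E) (V := X) (W := Y) (s := univ)
  rw [lieBracketWithin_univ] at h1
  exact congrFun h1 _

end VectorFields

end Charts

/-! ### Tangent and cotangent vectors of the cylinder -/

section Cylinder

variable {n : ℕ} {M : Type*} [TopologicalSpace M] [ChartedSpace (EuclideanSpace ℝ (Fin n)) M]

/-- The tangent vector `∂/∂v` of the cylinder. -/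
def vert (n : ℕ) {M : Type*} [TopologicalSpace M] [ChartedSpace (EuclideanSpace ℝ (Fin n)) M]
    (q : Cyl M) : TangentSpace (cylModel n) q :=
  ((0, 1) : EuclideanSpace ℝ (Fin n) × ℝ)

/-- The inclusion of the tangent space of `M` in the tangent space of the cylinder. -/
noncomputable def horiz (q : Cyl M) :
    TangentSpace (𝓡 n) q.1 →L[ℝ] TangentSpace (cylModel n) q :=
  ContinuousLinearMap.inl ℝ (EuclideanSpace ℝ (Fin n)) ℝ

theorem exists_eq_horiz_add_smul_vert (q : Cyl M) (w : TangentSpace (cylModel n) q) :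
    ∃ (X : TangentSpace (𝓡 n) q.1) (t : ℝ), w = horiz q X + t • vert n q := by
  have key : ∀ w : EuclideanSpace ℝ (Fin n) × ℝ, w = (w.1, 0) + w.2 • (0, 1) := fun w => by
    simp
  exact ⟨_, _, key w⟩

theorem smul_vert (q : Cyl M) (t : ℝ) :
    t • vert n q = ((0, t) : EuclideanSpace ℝ (Fin n) × ℝ) := by
  have key : t • ((0, 1) : EuclideanSpace ℝ (Fin n) × ℝ) = (0, t) := by simp
  exact key

theorem differential_horiz {W : Cyl M → ℝ} {q : Cyl M}
    (hW : MDifferentiableAt (cylModel n) 𝓘(ℝ, ℝ) W q) (X : TangentSpace (𝓡 n) q.1) :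
    differential n W q (horiz q X) = gradM n W q X := by
  refine (mfderiv_prod_eq_add_apply (v := horiz q X) hW).trans ?_
  have : mfderiv 𝓘(ℝ, ℝ) 𝓘(ℝ, ℝ) (fun s : PosReal => W (q.1, s)) q.2 (0 : ℝ) = 0 :=
    map_zero (mfderiv 𝓘(ℝ, ℝ) 𝓘(ℝ, ℝ) (fun s : PosReal => W (q.1, s)) q.2)
  exact (congrArg (fun t : ℝ => gradM n W q X + t) this).trans (add_zero _)

theorem differential_vert {W : Cyl M → ℝ} {q : Cyl M}
    (hW : MDifferentiableAt (cylModel n) 𝓘(ℝ, ℝ) W q) :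
    differential n W q (vert n q) = derivV W q := by
  refine (mfderiv_prod_eq_add_apply (v := vert n q) hW).trans ?_
  change gradM n W q (0 : EuclideanSpace ℝ (Fin n)) + derivV W q = _
  have : gradM n W q (0 : EuclideanSpace ℝ (Fin n)) = 0 := map_zero (gradM n W q)
  rw [this, zero_add]

theorem rulingTangent_eq (q : Cyl M) : rulingTangent n q = Submodule.span ℝ {vert n q} := by
  have h : mfderiv 𝓘(ℝ, ℝ) (cylModel n) (fun s : PosReal => ((q.1, s) : Cyl M)) q.2 =
    ContinuousLinearMap.inr ℝ (EuclideanSpace ℝ (Fin n)) ℝ := mfderiv_prod_right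
  ext w
  rw [Submodule.mem_span_singleton, rulingTangent, h]
  constructor
  · rintro ⟨t, rfl⟩
    exact ⟨t, smul_vert q t⟩
  · rintro ⟨t, rfl⟩
    exact ⟨t, (smul_vert q t).symm⟩

theorem isCompl_ker_rulingTangent_iff {q : Cyl M} (φ : TangentSpace (cylModel n) q →L[ℝ] ℝ) :
    IsCompl (LinearMap.ker (φ : TangentSpace (cylModel n) q →ₗ[ℝ] ℝ)) (rulingTangent n q) ↔
      φ (vert n q) ≠ 0 := by
  rw [rulingTangent_eq]
  have hv : vert n q ≠ 0 := fun h => one_ne_zero (congrArg Prod.snd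
    (show ((0, 1) : EuclideanSpace ℝ (Fin n) × ℝ) = 0 from h))
  constructor
  · intro h h0
    exact hv (Submodule.disjoint_def.1 h.disjoint _ h0 (Submodule.mem_span_singleton_self _))
  · intro h
    refine ⟨Submodule.disjoint_def.2 fun w hw hw' => ?_,
      Submodule.codisjoint_iff_exists_add_eq.2 fun w => ?_⟩
    · obtain ⟨t, rfl⟩ := Submodule.mem_span_singleton.1 hw'
      have h1 : t * φ (vert n q) = 0 := by
        have : φ (t • vert n q) = 0 := hw
        rwa [map_smul, smul_eq_mul] at this
      rw [(mul_eq_zero.1 h1).resolve_right h, zero_smul]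
    · refine ⟨w - (φ w / φ (vert n q)) • vert n q, (φ w / φ (vert n q)) • vert n q, ?_,
        Submodule.smul_mem _ _ (Submodule.mem_span_singleton_self _), sub_add_cancel _ _⟩
      change φ (w - (φ w / φ (vert n q)) • vert n q) = 0
      rw [map_sub, map_smul, smul_eq_mul, div_mul_cancel₀ _ h, sub_self]

/-- Representatives of a class differ by a nonzero scalar; this frees `kerSection` from the
arbitrary choice `rep`. -/
theorem mem_kerSection_iff {σ : ProjSection n M} {q : Cyl M}
    {φ : TangentSpace (cylModel n) q →L[ℝ] ℝ} (hφ : φ ≠ 0)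
    (h : σ q = Projectivization.mk ℝ φ hφ) (w : TangentSpace (cylModel n) q) :
    w ∈ kerSection σ q ↔ φ w = 0 := by
  have h1 : Projectivization.mk ℝ (σ q).rep (σ q).rep_nonzero = Projectivization.mk ℝ φ hφ := by
    rw [Projectivization.mk_rep, h]
  obtain ⟨c, hc⟩ := (Projectivization.mk_eq_mk_iff ℝ _ _ _ _).1 h1
  change (σ q).rep w = 0 ↔ _
  rw [← hc]
  change (c : ℝ) * φ w = 0 ↔ _
  simp

theorem kerSection_eq {σ : ProjSection n M} {q : Cyl M}
    {φ : TangentSpace (cylModel n) q →L[ℝ] ℝ} (hφ : φ ≠ 0)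
    (h : σ q = Projectivization.mk ℝ φ hφ) :
    kerSection σ q = LinearMap.ker (φ : TangentSpace (cylModel n) q →ₗ[ℝ] ℝ) := by
  ext w
  exact mem_kerSection_iff hφ h w

/-- The cylinder chart is a chart of `M` times the inclusion of the half-line, so differentiating it
along a ruling gives the same vector for every base point `q₀`. -/
theorem mfderiv_chart_vert [IsManifold (𝓡 n) ∞ M] {q₀ q : Cyl M}
    (hq : q ∈ (extChartAt (cylModel n) q₀).source) :
    mfderiv (cylModel n) 𝓘(ℝ, EuclideanSpace ℝ (Fin n) × ℝ) (extChartAt (cylModel n) q₀) q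
      (vert n q) = ((0, 1) : EuclideanSpace ℝ (Fin n) × ℝ) := by
  have h1 : mfderiv 𝓘(ℝ, ℝ) (cylModel n) (fun s : PosReal => ((q.1, s) : Cyl M)) q.2 =
    ContinuousLinearMap.inr ℝ (EuclideanSpace ℝ (Fin n)) ℝ := mfderiv_prod_right
  have h2 : MDifferentiableAt 𝓘(ℝ, ℝ) (cylModel n) (fun s : PosReal => ((q.1, s) : Cyl M)) q.2 :=
    mdifferentiableAt_const.prodMk mdifferentiableAt_id
  have h3 : MDifferentiableAt (cylModel n) 𝓘(ℝ, EuclideanSpace ℝ (Fin n) × ℝ)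
      (extChartAt (cylModel n) q₀) ((fun s : PosReal => ((q.1, s) : Cyl M)) q.2) :=
    (contMDiffAt_extChartAt' (n := ∞) (by simpa using hq)).mdifferentiableAt (by simp)
  have h4 := mfderiv_comp q.2 h3 h2
  have h5 : MDifferentiableAt 𝓘(ℝ, ℝ) 𝓘(ℝ, ℝ) (extChartAt 𝓘(ℝ, ℝ) q.2) q.2 :=
    mdifferentiableAt_extChartAt (mem_chart_source _ _)
  have h6 : HasMFDerivAt 𝓘(ℝ, ℝ) 𝓘(ℝ, ℝ) (extChartAt 𝓘(ℝ, ℝ) q.2) q.2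
      (ContinuousLinearMap.id ℝ ℝ) := by
    have := h5.hasMFDerivAt
    rwa [mfderiv_extChartAt_self] at this
  have h7 : HasMFDerivAt 𝓘(ℝ, ℝ) 𝓘(ℝ, EuclideanSpace ℝ (Fin n) × ℝ)
      (fun s : PosReal => ((extChartAt (𝓡 n) q₀.1 q.1, (s : ℝ)) : EuclideanSpace ℝ (Fin n) × ℝ))
      q.2 (ContinuousLinearMap.inr ℝ (EuclideanSpace ℝ (Fin n)) ℝ) := by
    have h8 : HasFDerivAt
      (fun t : ℝ => ((extChartAt (𝓡 n) q₀.1 q.1, t) : EuclideanSpace ℝ (Fin n) × ℝ))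
      (ContinuousLinearMap.inr ℝ (EuclideanSpace ℝ (Fin n)) ℝ) (q.2 : ℝ) :=
      (hasFDerivAt_const _ _).prodMk (hasFDerivAt_id _)
    exact HasMFDerivAt.comp q.2 h8.hasMFDerivAt h6
  have h9 := h7.mfderiv.symm.trans h4
  have h10 := congrArg (fun L : ℝ →L[ℝ] EuclideanSpace ℝ (Fin n) × ℝ => L 1) h9
  rw [h1] at h10
  exact h10.symm

end Cylinder

/-! ### What the force determines -/

section Metric

variable {n : ℕ} {M : Type*} [TopologicalSpace M] [ChartedSpace (EuclideanSpace ℝ (Fin n)) M]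
  [IsManifold (𝓡 n) ∞ M]

/-- The covector `∇W / W_v` in the formula for the force is determined by the force. -/
theorem eq_of_force_eq (g : Metric n M) {p : M} {v : PosReal} {a a' : ℝ}
    {b b' : TangentSpace (𝓡 n) p → ℝ} (hb : ∀ (t : ℝ) X, b (t • X) = t * b X)
    (hb' : ∀ (t : ℝ) X, b' (t • X) = t * b' X)
    (h : ∀ u : {u : TangentSpace (𝓡 n) p // u ≠ 0}, speed g p u = v → ∀ X,
      a * g.inner p (unitDir g p u) X -
          (v : ℝ) * (2 * b (unitDir g p u) * g.inner p (unitDir g p u) X - b X) =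
        a' * g.inner p (unitDir g p u) X -
          (v : ℝ) * (2 * b' (unitDir g p u) * g.inner p (unitDir g p u) X - b' X)) :
    b = b' := by
  have hv : (0 : ℝ) < v := v.2
  -- Contraction with `X = u`, where `g(N, u) = v`, reduces each side to `v` times the claimed one.
  have key : ∀ u : {u : TangentSpace (𝓡 n) p // u ≠ 0}, speed g p u = v →
      a - b u.1 = a' - b' u.1 := by
    intro u hu
    have h1 := h u hu u.1
    have hsq : g.inner p u.1 u.1 = (v : ℝ) ^ 2 := by
      rw [← hu]
      exact (Real.sq_sqrt (g.pos p u.1 u.2).le).symm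
    have hN : g.inner p (unitDir g p u) u.1 = v := by
      rw [unitDir, hu, map_smul]
      change (v : ℝ)⁻¹ * g.inner p u.1 u.1 = v
      rw [hsq]
      field_simp
    rw [hN, unitDir, hu, hb, hb'] at h1
    field_simp at h1
    linarith
  funext X
  by_cases hX : X = 0
  · have h1 := hb 0 X
    have h2 := hb' 0 X
    rw [zero_smul, zero_mul] at h1 h2
    rw [hX, h1, h2]
  have hpos := g.pos p X hX
  have hr : 0 < √(g.inner p X X) := Real.sqrt_pos.2 hpos
  have hsp : ∀ t : ℝ, |t| = v / √(g.inner p X X) → ∃ ht : t • X ≠ 0,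
      speed g p ⟨t • X, ht⟩ = v := by
    intro t ht
    have ht0 : t ≠ 0 := by
      rw [← abs_pos, ht]; positivity
    refine ⟨smul_ne_zero ht0 hX, Subtype.ext ?_⟩
    change √(g.inner p (t • X) (t • X)) = v
    have : g.inner p (t • X) (t • X) = t ^ 2 * g.inner p X X := by
      rw [map_smul]
      change t * g.inner p (t • X) X = _
      rw [map_smul]
      change t * (t * g.inner p X X) = _
      ring
    rw [this, Real.sqrt_mul (sq_nonneg t), Real.sqrt_sq_eq_abs, ht]
    field_simp
  -- Both multiples of `X` of length `v` are used: subtracting the two relations eliminates `a` and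
  -- `a'`.
  obtain ⟨h0, h1⟩ := hsp (v / √(g.inner p X X)) (abs_of_pos (by positivity))
  obtain ⟨h0', h1'⟩ := hsp (-(v / √(g.inner p X X)))
    (by rw [abs_neg]; exact abs_of_pos (by positivity))
  have h2 := key _ h1
  have h3 := key _ h1'
  simp only [hb, hb'] at h2 h3
  have hc : (v : ℝ) / √(g.inner p X X) ≠ 0 := by positivity
  refine mul_left_cancel₀ hc ?_
  linarith

/-- Every covector is represented by a vector with respect to the metric. -/
theorem exists_inner_eq (g : Metric n M) (p : M) (φ : TangentSpace (𝓡 n) p →L[ℝ] ℝ) :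
    ∃ F : TangentSpace (𝓡 n) p, ∀ X, g.inner p F X = φ X := by
  let L : EuclideanSpace ℝ (Fin n) →ₗ[ℝ] (EuclideanSpace ℝ (Fin n) →ₗ[ℝ] ℝ) :=
    (ContinuousLinearMap.coeLM ℝ : (EuclideanSpace ℝ (Fin n) →L[ℝ] ℝ) →ₗ[ℝ] _) ∘ₗ
      (show EuclideanSpace ℝ (Fin n) →L[ℝ] EuclideanSpace ℝ (Fin n) →L[ℝ] ℝ from
        g.inner p).toLinearMap
  have hinj : Function.Injective L := by
    rw [← LinearMap.ker_eq_bot, LinearMap.ker_eq_bot']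
    intro X hX
    by_contra h0
    have h1 := g.pos p X h0
    have h2 : g.inner p X X = 0 := congrArg (fun l : EuclideanSpace ℝ (Fin n) →ₗ[ℝ] ℝ => l X) hX
    exact h1.ne' h2
  have hsurj : Function.Surjective L :=
    (LinearMap.injective_iff_surjective_of_finrank_eq_finrank
      (Subspace.dual_finrank_eq (K := ℝ) (V := EuclideanSpace ℝ (Fin n))).symm).1 hinj
  obtain ⟨F, hF⟩ := hsurj (φ : TangentSpace (𝓡 n) p →ₗ[ℝ] ℝ)
  exact ⟨F, fun X => congrArg (fun l : EuclideanSpace ℝ (Fin n) →ₗ[ℝ] ℝ => l X) hF⟩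

end Metric

/-! ### From force fields to sections -/

variable {n : ℕ} {M : Type*} [TopologicalSpace M] [ChartedSpace (EuclideanSpace ℝ (Fin n)) M]

/-- Normalized to value `1` on `∂/∂v`, a covector is fixed by its horizontal part. -/
theorem mk_eq_mk_of_ratio {q : Cyl M} {φ ψ : TangentSpace (cylModel n) q →L[ℝ] ℝ} (hφ : φ ≠ 0)
    (hψ : ψ ≠ 0) (hφv : φ (vert n q) ≠ 0) (hψv : ψ (vert n q) ≠ 0)
    (h : ∀ X, φ (horiz q X) / φ (vert n q) = ψ (horiz q X) / ψ (vert n q)) :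
    Projectivization.mk ℝ φ hφ = Projectivization.mk ℝ ψ hψ := by
  refine (Projectivization.mk_eq_mk_iff' ℝ _ _ _ _).2
    ⟨φ (vert n q) / ψ (vert n q), ContinuousLinearMap.ext fun w => ?_⟩
  obtain ⟨X, t, rfl⟩ := exists_eq_horiz_add_smul_vert q w
  change φ (vert n q) / ψ (vert n q) * ψ (horiz q X + t • vert n q) = _
  have h1 := h X
  rw [map_add, map_add, map_smul, map_smul, smul_eq_mul, smul_eq_mul]
  field_simp at h1 ⊢
  linarith

variable [IsManifold (𝓡 n) ∞ M]

theorem Represents.mdifferentiableAt {g : Metric n M} {F : ForceField n M} {O : Set (Cyl M)}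
    {h : ℝ → ℝ} {W : Cyl M → ℝ} (H : Represents g F O h W) {q : Cyl M} (hq : q ∈ O) :
    MDifferentiableAt (cylModel n) 𝓘(ℝ, ℝ) W q :=
  (H.smooth_W.contMDiffAt (H.isOpen.mem_nhds hq)).mdifferentiableAt (by simp)

theorem Represents.differential_vert_ne_zero {g : Metric n M} {F : ForceField n M}
    {O : Set (Cyl M)} {h : ℝ → ℝ} {W : Cyl M → ℝ} (H : Represents g F O h W) {q : Cyl M}
    (hq : q ∈ O) : differential n W q (vert n q) ≠ 0 := by
  rw [differential_vert (H.mdifferentiableAt hq)]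
  exact H.derivV_ne_zero q hq

theorem Represents.differential_ne_zero {g : Metric n M} {F : ForceField n M}
    {O : Set (Cyl M)} {h : ℝ → ℝ} {W : Cyl M → ℝ} (H : Represents g F O h W) {q : Cyl M}
    (hq : q ∈ O) : differential n W q ≠ 0 := fun h0 =>
  H.differential_vert_ne_zero hq (by rw [h0]; rfl)

/-- Two pairs that represent the same force field define the same point of the projectivized
cotangent bundle. -/
theorem Represents.mk_eq_mk {g : Metric n M} {F : ForceField n M} {O O' : Set (Cyl M)}
    {h h' : ℝ → ℝ} {W W' : Cyl M → ℝ} (H : Represents g F O h W) (H' : Represents g F O' h' W')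
    {q : Cyl M} (hq : q ∈ O) (hq' : q ∈ O') :
    Projectivization.mk ℝ (differential n W q) (H.differential_ne_zero hq) =
      Projectivization.mk ℝ (differential n W' q) (H'.differential_ne_zero hq') := by
  refine mk_eq_mk_of_ratio _ _ (H.differential_vert_ne_zero hq)
    (H'.differential_vert_ne_zero hq') ?_
  intro X
  rw [differential_vert (H.mdifferentiableAt hq), differential_vert (H'.mdifferentiableAt hq'),
    differential_horiz (H.mdifferentiableAt hq), differential_horiz (H'.mdifferentiableAt hq')]
  obtain ⟨p, v⟩ := q
  have key := eq_of_force_eq g (p := p) (v := v)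
    (a := h (W (p, v)) / derivV W (p, v)) (a' := h' (W' (p, v)) / derivV W' (p, v))
    (b := fun X => gradM n W (p, v) X / derivV W (p, v))
    (b' := fun X => gradM n W' (p, v) X / derivV W' (p, v))
    (fun t X => by rw [map_smul, smul_eq_mul, mul_div_assoc])
    (fun t X => by rw [map_smul, smul_eq_mul, mul_div_assoc]) (fun u hu Z => by
      subst hu
      have h1 := H.formula p u hq Z
      rw [H'.formula p u hq' Z] at h1
      rw [div_mul_eq_mul_div, div_mul_eq_mul_div]
      exact h1.symm)
  exact congrFun key X

/-- The section of the projectivized cotangent bundle determined by a force field. -/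
theorem exists_section (g : Metric n M) (F : ForceField n M) (hF : HasNormalShiftForm g F) :
    ∃ σ : ProjSection n M, Determines g F σ ∧
      (∀ σ' : ProjSection n M, Determines g F σ' → σ' = σ) ∧
      IsSmoothSection σ ∧ IsClosedSection σ ∧ IsTransversal σ := by
  choose O h W hO H using hF
  let σ : ProjSection n M := fun q =>
    Projectivization.mk ℝ (differential n (W q) q) ((H q).differential_ne_zero (hO q))
  have hσ : Determines g F σ := fun O' h' W' H' q hq =>
    ⟨H'.differential_ne_zero hq, (H q).mk_eq_mk H' (hO q) hq⟩
  refine ⟨σ, hσ, fun σ' hσ' => ?_, fun q₀ => ?_, ?_, fun q => ?_⟩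
  -- Some pair represents the force near each `q`, and it forces the value there.
  · funext q
    exact (hσ' _ _ _ (H q) q (hO q)).2
  · exact ⟨O q₀, differential n (W q₀), (H q₀).isOpen, hO q₀,
      contMDiffOn_mfderiv (H q₀).isOpen (H q₀).smooth_W, fun q hq => hσ _ _ _ (H q₀) q hq⟩
  · intro O' X Y hO' hX hY hXk hYk q hq
    have hopen := hO'.inter (H q).isOpen
    have hd : ∀ r ∈ O' ∩ O q, ∀ w, w ∈ kerSection σ r ↔ differential n (W q) r w = 0 :=
      fun r hr w => mem_kerSection_iff _ (hσ _ _ _ (H q) r hr.2).2 w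
    refine (hd q ⟨hq, hO q⟩ _).2 ?_
    refine mfderiv_mlieBracket_eq_zero hopen ((H q).smooth_W.mono inter_subset_right)
      ⟨hq, hO q⟩ ((hX.contMDiffAt (hO'.mem_nhds hq)).mdifferentiableAt (by simp))
      ((hY.contMDiffAt (hO'.mem_nhds hq)).mdifferentiableAt (by simp))
      (fun r hr => (hd r hr _).1 (hXk r hr.1)) (fun r hr => (hd r hr _).1 (hYk r hr.1))
  · rw [kerSection_eq _ (hσ _ _ _ (H q) q (hO q)).2, isCompl_ker_rulingTangent_iff]
    exact (H q).differential_vert_ne_zero (hO q)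

/-! ### From sections to force fields -/

/-- A smooth closed section transversal to the rulings is locally the class of the differential
of a function. -/
theorem exists_local_potential {σ : ProjSection n M} (hs : IsSmoothSection σ)
    (hc : IsClosedSection σ) (ht : IsTransversal σ) (q₀ : Cyl M) :
    ∃ (O : Set (Cyl M)) (W : Cyl M → ℝ), IsOpen O ∧ q₀ ∈ O ∧
      ContMDiffOn (cylModel n) 𝓘(ℝ, ℝ) ∞ W O ∧ ∀ q ∈ O, derivV W q ≠ 0 ∧
        ∃ hW : differential n W q ≠ 0, σ q = Projectivization.mk ℝ (differential n W q) hW := by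
  obtain ⟨O, θ, hO, hq₀, hθs, hθ⟩ := hs q₀
  set e := extChartAt (cylModel n) q₀ with he
  have : IsManifold (cylModel n) 1 (Cyl M) := .of_le (n := ∞) (by simp)
  have hO₁ : IsOpen (O ∩ e.source) := hO.inter (isOpen_extChartAt_source q₀)
  have hform : ContMDiffOn (cylModel n) 𝓘(ℝ, EuclideanSpace ℝ (Fin n) × ℝ →L[ℝ] ℝ) ∞
      (chartForm (cylModel n) q₀ θ) (O ∩ e.source) :=
    (contMDiffOn_form_iff hO₁ inter_subset_right).1 (hθs.mono inter_subset_left)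
  let β : EuclideanSpace ℝ (Fin n) × ℝ → EuclideanSpace ℝ (Fin n) × ℝ →L[ℝ] ℝ :=
    chartForm (cylModel n) q₀ θ ∘ e.symm
  have hβ : ∀ q ∈ O ∩ e.source, β (e q) = chartForm (cylModel n) q₀ θ q := fun q hq =>
    congrArg (chartForm (cylModel n) q₀ θ) (e.left_inv hq.2)
  have hβs : ∀ q ∈ O ∩ e.source, ContDiffAt ℝ ∞ β (e q) := fun q hq =>
    contDiffAt_comp_chart_symm hq.2 (hform.contMDiffAt (hO₁.mem_nhds hq))
  have hker : ∀ q ∈ O, ∀ w, w ∈ kerSection σ q ↔ θ q w = 0 := fun q hq w =>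
    mem_kerSection_iff (hθ q hq).1 (hθ q hq).2 w
  have hθv : ∀ q ∈ O, θ q (vert n q) ≠ 0 := by
    intro q hq
    have h1 := ht q
    rwa [kerSection_eq (hθ q hq).1 (hθ q hq).2, isCompl_ker_rulingTangent_iff] at h1
  let c : EuclideanSpace ℝ (Fin n) × ℝ → ℝ := fun y => β y (0, 1)
  have hcs : ∀ q ∈ O ∩ e.source, ContDiffAt ℝ ∞ c (e q) := fun q hq =>
    (hβs q hq).clm_apply contDiffAt_const
  have hcv : ∀ q ∈ O ∩ e.source, c (e q) = θ q (vert n q) := by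
    intro q hq
    have h1 := chartForm_mfderiv (I := cylModel n) hq.2 θ (vert n q)
    rw [mfderiv_chart_vert hq.2, ← hβ q hq] at h1
    exact h1
  have hc0 : ∀ q ∈ O ∩ e.source, c (e q) ≠ 0 := fun q hq => by
    rw [hcv q hq]; exact hθv q hq.1
  -- Transversality makes the `dv`-coefficient `c` nonzero, so the form can be written as `c (dv - a
  -- dx)`.
  let a : EuclideanSpace ℝ (Fin n) × ℝ → EuclideanSpace ℝ (Fin n) →L[ℝ] ℝ := fun y =>
    -((c y)⁻¹ • (β y ∘L ContinuousLinearMap.inl ℝ (EuclideanSpace ℝ (Fin n)) ℝ))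
  have has : ∀ q ∈ O ∩ e.source, ContDiffAt ℝ ∞ a (e q) := fun q hq =>
    (((hcs q hq).inv (hc0 q hq)).smul ((hβs q hq).clm_comp contDiffAt_const)).neg
  have hβa : ∀ q ∈ O ∩ e.source, ∀ ξ t, β (e q) (ξ, t) = c (e q) * (t - a (e q) ξ) := by
    intro q hq ξ t
    have h1 : ((ξ, t) : EuclideanSpace ℝ (Fin n) × ℝ) = (ξ, 0) + t • (0, 1) := by simp
    have h2 : a (e q) ξ = -((c (e q))⁻¹ * β (e q) (ξ, 0)) := rfl
    have h3 := hc0 q hq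
    rw [h1, map_add, map_smul, h2, smul_eq_mul]
    change _ + t * c (e q) = _
    field_simp
    ring
  have hnear : ∀ᶠ y in 𝓝 (e q₀), ∃ q ∈ O ∩ e.source, e q = y := by
    have h1 : ∀ᶠ y in 𝓝 (e q₀), e.symm y ∈ O :=
      (continuousAt_extChartAt_symm q₀).eventually
        (by rw [extChartAt_to_inv]; exact hO.mem_nhds hq₀)
    filter_upwards [h1, (isOpen_extChartAt_target q₀).mem_nhds (mem_extChartAt_target q₀)]
      with y hy hyt
    exact ⟨e.symm y, ⟨hy, e.map_target hyt⟩, e.right_inv hyt⟩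
  -- The lift of the constant field `ξ` to the kernel. Brackets of such lifts are vertical, and a
  -- vertical vector in the kernel is zero; this is the integrability condition.
  let X : EuclideanSpace ℝ (Fin n) → EuclideanSpace ℝ (Fin n) × ℝ →
    EuclideanSpace ℝ (Fin n) × ℝ := fun ξ y => (ξ, a y ξ)
  have hXs : ∀ ξ, ∀ q ∈ O ∩ e.source, ContDiffAt ℝ ∞ (X ξ) (e q) := fun ξ q hq =>
    contDiffAt_const.prodMk ((has q hq).clm_apply contDiffAt_const)
  have hXk : ∀ ξ, ∀ q ∈ O ∩ e.source,
      mpullback (cylModel n) 𝓘(ℝ, EuclideanSpace ℝ (Fin n) × ℝ) e (X ξ) q ∈ kerSection σ q := by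
    intro ξ q hq
    refine (hker q hq.1 _).2 ?_
    change chartForm (cylModel n) q₀ θ q (ξ, a (e q) ξ) = 0
    rw [← hβ q hq, hβa q hq, sub_self, mul_zero]
  have hXd : ∀ ξ, ∀ q ∈ O ∩ e.source, ∀ w, fderiv ℝ (X ξ) (e q) w = (0, fderiv ℝ a (e q) w ξ) := by
    intro ξ q hq w
    have h1 := ((has q hq).differentiableAt (by simp)).hasFDerivAt
    have h2 := (hasFDerivAt_const ξ (e q)).prodMk (h1.clm_apply (hasFDerivAt_const ξ (e q)))
    have h3 : fderiv ℝ (X ξ) (e q) = _ := h2.fderiv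
    rw [h3]
    simp
  have hint : ∀ᶠ y in 𝓝 (e q₀), ∀ ξ η,
      fderiv ℝ a y (ξ, a y ξ) η = fderiv ℝ a y (η, a y η) ξ := by
    filter_upwards [hnear] with y ⟨q, hq, hy⟩ ξ η
    subst hy
    have h1 := hc (O ∩ e.source) _ _ hO₁
      (contMDiffOn_mpullback_chart inter_subset_right (hXs ξ))
      (contMDiffOn_mpullback_chart inter_subset_right (hXs η)) (hXk ξ) (hXk η) q hq
    rw [hker q hq.1, mlieBracket_mpullback_chart hq.2 (hXs ξ q hq) (hXs η q hq)] at h1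
    change chartForm (cylModel n) q₀ θ q
      (fderiv ℝ (X η) (e q) (X ξ (e q)) - fderiv ℝ (X ξ) (e q) (X η (e q))) = 0 at h1
    rw [← hβ q hq, hXd η q hq, hXd ξ q hq, Prod.mk_sub_mk, sub_self, hβa q hq, map_zero,
      sub_zero] at h1
    exact sub_eq_zero.1 ((mul_eq_zero.1 h1).resolve_left (hc0 q hq))
  obtain ⟨W, hW⟩ := exists_first_integral
    (hnear.mono fun y ⟨q, hq, hy⟩ => hy ▸ has q hq) hint
  have hmem : ∀ᶠ q in 𝓝 q₀, q ∈ O ∩ e.source :=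
    hO₁.mem_nhds ⟨hq₀, mem_extChartAt_source q₀⟩
  have hev : ∀ᶠ q in 𝓝 q₀, q ∈ O ∩ e.source ∧ ContDiffAt ℝ ∞ W (e q) ∧
      fderiv ℝ W (e q) (0, 1) ≠ 0 ∧
      ∀ h, fderiv ℝ W (e q) h = fderiv ℝ W (e q) (0, 1) * (h.2 - a (e q) h.1) :=
    hmem.and ((continuousAt_extChartAt q₀).eventually hW)
  obtain ⟨O₂, hO₂, hO₂o, hq₂⟩ := eventually_nhds_iff.1 hev
  have hWs : ∀ q ∈ O₂, ContMDiffAt (cylModel n) 𝓘(ℝ, ℝ) ∞ (W ∘ e) q := fun q hq =>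
    ContMDiffAt.comp q (hO₂ q hq).2.1.contMDiffAt
      (contMDiffAt_extChartAt' (by simpa [he] using (hO₂ q hq).1.2))
  refine ⟨O₂, W ∘ e, hO₂o, hq₂, fun q hq => (hWs q hq).contMDiffWithinAt, fun q hq => ?_⟩
  obtain ⟨hq₁, hWq, hWv, hWd⟩ := hO₂ q hq
  have hdiff : ∀ w, differential n (W ∘ e) q w =
      fderiv ℝ W (e q) (0, 1) / c (e q) * θ q w := by
    intro w
    have h1 := mfderiv_comp q (hWq.differentiableAt (by simp)).mdifferentiableAt
      ((contMDiffAt_extChartAt' (I := cylModel n) (n := ∞) (x := q₀) (x' := q)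
        (by simpa [he] using hq₁.2)).mdifferentiableAt (by simp))
    have h2 : differential n (W ∘ e) q w = fderiv ℝ W (e q)
        (mfderiv (cylModel n) 𝓘(ℝ, EuclideanSpace ℝ (Fin n) × ℝ) e q w) := by
      rw [mfderiv_eq_fderiv] at h1
      exact congrArg (fun L : EuclideanSpace ℝ (Fin n) × ℝ →L[ℝ] ℝ => L w) h1
    have h3 := chartForm_mfderiv (I := cylModel n) hq₁.2 θ w
    rw [← hβ q hq₁] at h3
    rw [h2, ← h3]
    refine (hWd _).trans ?_
    refine (?_ : _ = fderiv ℝ W (e q) (0, 1) / c (e q) * (c (e q) * _)).trans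
      (congrArg _ (hβa q hq₁ _ _).symm)
    rw [← mul_assoc, div_mul_cancel₀ _ (hc0 q hq₁)]
    rfl
  have hr : fderiv ℝ W (e q) (0, 1) / c (e q) ≠ 0 := div_ne_zero hWv (hc0 q hq₁)
  have hv : differential n (W ∘ e) q (vert n q) ≠ 0 := by
    rw [hdiff]
    exact mul_ne_zero hr (hθv q hq₁.1)
  have hne : differential n (W ∘ e) q ≠ 0 := fun h0 => hv (by rw [h0]; rfl)
  refine ⟨?_, hne, ?_⟩
  · rwa [← differential_vert ((hWs q hq).mdifferentiableAt (by simp))]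
  · rw [(hθ q hq₁.1).2]
    refine ((Projectivization.mk_eq_mk_iff' ℝ _ _ _ _).2
      ⟨fderiv ℝ W (e q) (0, 1) / c (e q), ContinuousLinearMap.ext fun w => ?_⟩).symm
    exact (hdiff w).symm

/-- Every smooth closed section transversal to the rulings is determined by a force field. -/
theorem exists_forceField (g : Metric n M) {σ : ProjSection n M} (hs : IsSmoothSection σ)
    (hc : IsClosedSection σ) (ht : IsTransversal σ) :
    ∃ F : ForceField n M, HasNormalShiftForm g F ∧ Determines g F σ := by
  -- The quotient removes the scale of `rep`, so `b` equals `∇W/W_v` for every local potential `W`.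
  -- Thus the formula with `h = 0` is global although `W` is only local.
  let b : ∀ q : Cyl M, TangentSpace (𝓡 n) q.1 →L[ℝ] ℝ := fun q =>
    ((σ q).rep (vert n q))⁻¹ • ((σ q).rep ∘L horiz q)
  have hF : ∀ (p : M) (u : {u : TangentSpace (𝓡 n) p // u ≠ 0}), ∃ F : TangentSpace (𝓡 n) p,
      ∀ X, g.inner p F X = -((speed g p u : ℝ) * (2 * b (p, speed g p u) (unitDir g p u) *
        g.inner p (unitDir g p u) X - b (p, speed g p u) X)) := fun p u =>
    exists_inner_eq g p (-((speed g p u : ℝ) • ((2 * b (p, speed g p u) (unitDir g p u)) •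
        g.inner p (unitDir g p u) - b (p, speed g p u))))
  choose F hF using hF
  choose O W hO hqO hWs hW using exists_local_potential hs hc ht
  have H : ∀ q, Represents g F (O q) (fun _ => 0) (W q) := by
    intro q₀
    refine ⟨hO q₀, hWs q₀, contDiffOn_const, fun q hq => (hW q₀ q hq).1, fun p u hu X => ?_⟩
    obtain ⟨hv, hd, hσ⟩ := hW q₀ _ hu
    have hmd : MDifferentiableAt (cylModel n) 𝓘(ℝ, ℝ) (W q₀) (p, speed g p u) :=
      ((hWs q₀).contMDiffAt ((hO q₀).mem_nhds hu)).mdifferentiableAt (by simp)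
    have hb : ∀ X, b (p, speed g p u) X =
        gradM n (W q₀) (p, speed g p u) X / derivV (W q₀) (p, speed g p u) := by
      intro X
      have h1 : Projectivization.mk ℝ (σ (p, speed g p u)).rep
          (σ (p, speed g p u)).rep_nonzero =
          Projectivization.mk ℝ (differential n (W q₀) (p, speed g p u)) hd := by
        rw [Projectivization.mk_rep, hσ]
      obtain ⟨k, hk⟩ := (Projectivization.mk_eq_mk_iff ℝ _ _ _ _).1 h1
      have hk0 : (k : ℝ) ≠ 0 := k.ne_zero
      have h2 : ∀ w, (σ (p, speed g p u)).rep w =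
          k * differential n (W q₀) (p, speed g p u) w := fun w => by
        rw [← hk]; rfl
      change ((σ (p, speed g p u)).rep (vert n _))⁻¹ * (σ (p, speed g p u)).rep (horiz _ X) = _
      rw [h2, h2, differential_vert hmd, differential_horiz hmd]
      field_simp
    rw [hF, hb, hb]
    ring
  refine ⟨F, fun q => ⟨O q, _, W q, hqO q, H q⟩, fun O' h' W' H' q hq => ?_⟩
  refine ⟨H'.differential_ne_zero hq, ?_⟩
  rw [(hW q q (hqO q)).2.2]
  exact (H q).mk_eq_mk H' (hqO q) hq

end NormalShift

theorem theorem5p1 (n : ℕ) {M : Type*} [TopologicalSpace M]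
    [ChartedSpace (EuclideanSpace ℝ (Fin n)) M] [IsManifold (𝓡 n) ∞ M]
    (g : NormalShift.Metric n M) :
    (∀ F : NormalShift.ForceField n M, NormalShift.HasNormalShiftForm g F →
      ∃ σ : NormalShift.ProjSection n M,
        NormalShift.Determines g F σ ∧
        (∀ σ' : NormalShift.ProjSection n M, NormalShift.Determines g F σ' → σ' = σ) ∧
        NormalShift.IsSmoothSection σ ∧
        NormalShift.IsClosedSection σ ∧
        NormalShift.IsTransversal σ) ∧
    (∀ σ : NormalShift.ProjSection n M,
      NormalShift.IsSmoothSection σ →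
      NormalShift.IsClosedSection σ →
      NormalShift.IsTransversal σ →
      ∃ F : NormalShift.ForceField n M,
        NormalShift.HasNormalShiftForm g F ∧ NormalShift.Determines g F σ) :=
  ⟨NormalShift.exists_section g, fun _ hs hc ht => NormalShift.exists_forceField g hs hc ht⟩
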